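/- All graphs are finite and simple. The detour order $\tau(G)$ of a graph $G$ is the number of vertices of a longest path of $G$, and $G$ is detour-saturated if $\tau(G+e)>\tau(G)$ for every edge $e$ of the complement of $G$. For a vertex $x$ of $G$ with neighbours $y_1,\dots,y_d$, let $G_s[x]$ be the graph obtained from $G$ by replacing $x$ with $d$ independent vertices $x_1,\dots,x_d$ and joining $x_i$ to $y_i$ only, $i=1,\dots,d$. For odd $k\ge 3$ let $J_k$ be Isaacs' graph (flower snark): its vertices are the $4k$ pairs $(j,r)$ with $j\in\mathbb Z/k\mathbb Z$ and $r\in\{0,1,2,3\}$, and its edges join $(j,0)$ to $(j,1),(j,2),(j,3)$, and $(j,1)$ to $(j+1,3)$, $(j,2)$ to $(j+1,2)$, $(j,3)$ to $(j+1,1)$, for all $j$. Let $CT$ be the Coxeter graph: its vertices are the $28$ pairs $(j,r)$ with $j\in\mathbb Z/7\mathbb Z$ and $r\in\{0,1,2,3\}$, and its edges join $(j,0)$ to $(j,1),(j,2),(j,3)$, and $(j,r)$ to $(j+r,r)$ for $r=1,2,3$ and all $j$. **Theorem 4.** There are detour-saturated graphs of girth $6$ of infinitely many orders. Namely, for every odd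 integer $k\ge 7$ and every vertex $x$ of $J_k$, the graph $(J_k)_s[x]$ is a detour-saturated graph of girth $6$ and order $4k+2$. Moreover, there exists a detour-saturated graph of girth $7$ and order $30$; namely, for every vertex $x$ of $CT$, the graph $CT_s[x]$ is a detour-saturated graph of girth $7$ and order $30$. -/

import Mathlib

/-- The detour order of a finite graph: the number of vertices of a longest path.
(The set is bounded by the number of vertices, so the supremum is a maximum.) -/
noncomputable def detourOrder {V : Type*} (G : SimpleGraph V) : ℕ :=
  sSup {n : ℕ | ∃ (u v : V) (p : G.Walk u v), p.IsPath ∧ p.support.length = n}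

/-- A graph is detour-saturated if adding any edge of the complement
increases the detour order. -/
def DetourSaturated {V : Type*} (G : SimpleGraph V) : Prop :=
  ∀ u v : V, u ≠ v → ¬ G.Adj u v → detourOrder G < detourOrder (G ⊔ SimpleGraph.edge u v)

/-- The graph `G` split `x`: the vertex `x` is replaced by independent vertices, one for each
neighbour `y` of `x`; the new vertex belonging to `y` is joined to `y` only. -/
def splitVertex {V : Type*} (G : SimpleGraph V) (x : V) :
    SimpleGraph ({v : V // v ≠ x} ⊕ {y : V // G.Adj x y}) where
  Adj a b :=
    match a, b with
    | Sum.inl u, Sum.inl v => G.Adj u.1 v.1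
    | Sum.inl u, Sum.inr y => u.1 = y.1
    | Sum.inr y, Sum.inl u => u.1 = y.1
    | Sum.inr _, Sum.inr _ => False
  symm := ⟨by
    rintro (u | y) (v | z) h
    · exact SimpleGraph.Adj.symm h
    · exact h
    · exact h
    · exact h⟩
  loopless := ⟨by
    rintro (u | y) h
    · exact G.irrefl h
    · exact h⟩

/-- Isaacs' graph `J_k` (meant for odd `k ≥ 3`), on the `4k` vertices `(j, r)`, `j` modulo `k`
and `r = 0, 1, 2, 3`. The edges join `(j, 0)` to `(j, 1)`, `(j, 2)`, `(j, 3)`, and `(j, 1)` to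
`(j + 1, 3)`, `(j, 2)` to `(j + 1, 2)`, `(j, 3)` to `(j + 1, 1)`. As `k` is odd, the vertices
`(j, 2)` form a `k`-cycle and the vertices `(j, 1)`, `(j, 3)` form one `2k`-cycle. -/
def isaacsGraph (k : ℕ) : SimpleGraph (ZMod k × Fin 4) :=
  SimpleGraph.fromRel fun a b =>
    (b.1 = a.1 ∧ a.2 = 0 ∧ b.2 ≠ 0) ∨
    (b.1 = a.1 + 1 ∧
      ((a.2 = 1 ∧ b.2 = 3) ∨ (a.2 = 2 ∧ b.2 = 2) ∨ (a.2 = 3 ∧ b.2 = 1)))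

/-- The Coxeter graph, on the 28 vertices `(j, r)`, `j` modulo `7` and `r = 0, 1, 2, 3`.
The edges join `(j, 0)` to `(j, 1)`, `(j, 2)`, `(j, 3)`, and `(j, r)` to `(j + r, r)`
for `r = 1, 2, 3`. -/
def coxeterGraph : SimpleGraph (ZMod 7 × Fin 4) :=
  SimpleGraph.fromRel fun a b =>
    (b.1 = a.1 ∧ a.2 = 0 ∧ b.2 ≠ 0) ∨
    (a.2 ≠ 0 ∧ b.2 = a.2 ∧ b.1 = a.1 + (a.2.val : ZMod 7))

/-! Let `G` be a cubic nonhamiltonian graph in which any two nonadjacent vertices are joined by a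
Hamiltonian path, and let `x` be a vertex such that for every neighbour `y` of `x` some cycle misses
only `y`. In the split graph, leaves can only be ends of a path. A path with more than `|V|`
vertices would therefore run from leaf to leaf through all vertices other than `x`, and gluing its
end leaves together at `x` would give a Hamiltonian cycle of `G`. So the detour order is at most
`|V|`. After adding any missing edge, a Hamiltonian path or almost Hamiltonian cycle of `G` can be
rearranged into a path with at least `|V| + 1` vertices; this is `splitVertex.detourSaturated`. For
the girth, a cycle of the split graph projects to a closed nonbacktracking walk of `G`, while a
shortest cycle of `G` avoiding `x` survives (`splitVertex.girth_eq`).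

It remains to supply the properties of `G`. For `J_k`, a Hamiltonian cycle would give a proper
3-edge-colouring, but a two-valued invariant of the colours between consecutive columns flips at
each column, which is impossible for odd `k`. Hamiltonian paths and almost Hamiltonian cycles come
from a strip covering `J_k`: blocks of columns are swept by one strand or by two parallel strands,
with small hand-made pieces near the ends of the path. For the Coxeter graph nonhamiltonicity is a
pruned exhaustive search, and the paths and cycles are explicit certificates, reduced by rotation to
an end or a missed vertex in column 0. -/

open SimpleGraph

/-! ### Detour orders through duplicate-free chains of vertices. -/

section DetourOrder

variable {V W : Type*}

theorem detourOrder_bddAbove [Finite V] (G : SimpleGraph V) :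
    BddAbove {n : ℕ | ∃ (u v : V) (p : G.Walk u v), p.IsPath ∧ p.support.length = n} := by
  have := Fintype.ofFinite V
  refine ⟨Fintype.card V, ?_⟩
  rintro n ⟨u, v, p, hp, rfl⟩
  exact hp.support_nodup.length_le_card

theorem length_le_detourOrder [Finite V] {G : SimpleGraph V} {l : List V} (hl : l ≠ [])
    (hc : l.IsChain G.Adj) (hn : l.Nodup) : l.length ≤ detourOrder G := by
  refine le_csSup (detourOrder_bddAbove G) ⟨_, _, Walk.ofSupport l hl hc, ?_, ?_⟩
  · rw [Walk.isPath_def, Walk.support_ofSupport]; exact hn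
  · rw [Walk.support_ofSupport]

theorem detourOrder_le {G : SimpleGraph V} {n : ℕ}
    (h : ∀ l : List V, l.IsChain G.Adj → l.Nodup → l.length ≤ n) : detourOrder G ≤ n := by
  rcases Set.eq_empty_or_nonempty
    {n : ℕ | ∃ (u v : V) (p : G.Walk u v), p.IsPath ∧ p.support.length = n} with h0 | h0
  · rw [detourOrder, h0]; simp
  · refine csSup_le h0 ?_
    rintro n ⟨u, v, p, hp, rfl⟩
    exact h _ p.isChain_adj_support hp.support_nodup

theorem detourOrder_le_of_embedding [Finite W] {G : SimpleGraph V} {H : SimpleGraph W}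
    (f : G →g H) (hf : Function.Injective f) : detourOrder G ≤ detourOrder H := by
  refine detourOrder_le fun l hc hn => ?_
  rcases eq_or_ne l [] with rfl | hl
  · simp
  · rw [← List.length_map (f := f)]
    refine length_le_detourOrder (by simpa using hl) ?_ (hn.map hf)
    exact List.isChain_map_of_isChain f (fun _ _ h => f.map_adj h) hc

theorem SimpleGraph.Iso.detourOrder_eq [Finite V] [Finite W] {G : SimpleGraph V}
    {H : SimpleGraph W} (f : G ≃g H) : detourOrder G = detourOrder H :=
  le_antisymm (detourOrder_le_of_embedding f.toHom f.injective)
    (detourOrder_le_of_embedding f.symm.toHom f.symm.injective)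

theorem DetourSaturated.of_iso [Finite V] [Finite W] {G : SimpleGraph V}
    {H : SimpleGraph W} (f : G ≃g H) (hG : DetourSaturated G) : DetourSaturated H := by
  intro u v huv hadj
  have h := hG (f.symm u) (f.symm v) (f.symm.injective.ne huv) (by rwa [f.symm.map_adj_iff])
  rw [← f.detourOrder_eq]
  refine h.trans_le (detourOrder_le_of_embedding ⟨f, ?_⟩ f.injective)
  intro a b hab
  simp only [sup_adj, edge_adj] at hab ⊢
  rcases hab with hab | ⟨hab, hne⟩
  · exact Or.inl (f.map_adj_iff.2 hab)
  · refine Or.inr ⟨?_, f.injective.ne hne⟩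
    rcases hab with ⟨rfl, rfl⟩ | ⟨rfl, rfl⟩ <;> simp

theorem exists_walk_support_eq {G : SimpleGraph V} {l : List V} {a b : V}
    (hc : l.IsChain G.Adj) (ha : l.head? = some a) (hb : l.getLast? = some b) :
    ∃ p : G.Walk a b, p.support = l := by
  have hl : l ≠ [] := by rintro rfl; simp at ha
  obtain rfl : l.head hl = a := by simpa [List.head?_eq_some_head hl] using ha
  obtain rfl : l.getLast hl = b := by simpa [List.getLast?_eq_some_getLast hl] using hb
  exact ⟨Walk.ofSupport l hl hc, Walk.support_ofSupport hl hc⟩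

theorem SimpleGraph.Walk.head?_support {G : SimpleGraph V} {a b : V} (p : G.Walk a b) :
    p.support.head? = some a := by
  rw [List.head?_eq_some_head p.support_ne_nil, p.head_support]

theorem SimpleGraph.Walk.getLast?_support {G : SimpleGraph V} {a b : V} (p : G.Walk a b) :
    p.support.getLast? = some b := by
  rw [List.getLast?_eq_some_getLast p.support_ne_nil, p.getLast_support]

end DetourOrder

/-! ### Splitting a vertex of a maximally nonhamiltonian graph. -/

namespace splitVertex

variable {V : Type*} {G : SimpleGraph V} {x : V}

theorem chain_map_inl {l : List {v : V // v ≠ x}} :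
    (l.map Sum.inl).IsChain (splitVertex G x).Adj ↔ (l.map Subtype.val).IsChain G.Adj := by
  rw [List.isChain_map, List.isChain_map]; rfl

/-- A leaf of the split graph occurs in a path only as an end. -/
theorem forall_interior_isLeft {a b : {v : V // v ≠ x} ⊕ {y : V // G.Adj x y}}
    {l : List ({v : V // v ≠ x} ⊕ {y : V // G.Adj x y})}
    (hc : (a :: l ++ [b]).IsChain (splitVertex G x).Adj) (hn : (a :: l ++ [b]).Nodup) :
    ∃ m : List {v : V // v ≠ x}, l = m.map Sum.inl := by
  induction l generalizing a with
  | nil => exact ⟨[], rfl⟩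
  | cons c l ih =>
    obtain ⟨m, rfl⟩ := ih (a := c) (by simpa using hc.tail) (by simpa using hn.tail)
    rcases c with c | y
    · exact ⟨c :: m, rfl⟩
    · exfalso
      rcases m with _ | ⟨d, m⟩
      · rcases a with a | a <;> rcases b with b | b <;>
          simp_all [splitVertex, Subtype.ext_iff]
      · rcases a with a | a <;> simp_all [splitVertex, Subtype.ext_iff]

/-- The interior of a longer path would contain all `|V| - 1` vertices other than `x`, so both ends
would be leaves. Replacing the first leaf by `x` gives a Hamiltonian path of `G` from `x` to a
neighbour of `x`, which `hG` excludes. -/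
theorem length_le_card [Fintype V] [DecidableEq V]
    (hG : ∀ y (p : G.Walk x y), p.IsHamiltonian → ¬ G.Adj x y)
    {l : List ({v : V // v ≠ x} ⊕ {y : V // G.Adj x y})}
    (hc : l.IsChain (splitVertex G x).Adj) (hn : l.Nodup) :
    l.length ≤ Fintype.card V := by
  have hpos : 0 < Fintype.card V := Fintype.card_pos_iff.2 ⟨x⟩
  rcases l with _ | ⟨a, l⟩
  · simp
  rcases List.eq_nil_or_concat' l with rfl | ⟨l, b, rfl⟩
  · simpa using Nat.succ_le_of_lt hpos
  obtain ⟨m, rfl⟩ := forall_interior_isLeft hc hn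
  have hmn : m.Nodup := by
    have := hn.sublist (l₁ := m.map Sum.inl) (by simp)
    exact List.Nodup.of_map _ this
  have hcard : Fintype.card {v : V // v ≠ x} + 1 = Fintype.card V := by
    rw [Fintype.card_subtype_compl, Fintype.card_subtype_eq]; omega
  by_contra hlt
  simp only [List.length_cons, List.length_append, List.length_map, List.length_nil] at hlt
  have hle := hmn.length_le_card
  have hmem : ∀ v, v ∈ m := by
    have := (Finset.card_eq_iff_eq_univ m.toFinset).1
      (by rw [List.toFinset_card_of_nodup hmn]; omega)
    intro v; simpa using (Finset.ext_iff.1 this v)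
  rcases a with a | y
  · have := hmem a; simp_all
  rcases b with b | z
  · have := hmem b
    simp only [List.nodup_cons, List.nodup_append] at hn
    exact hn.2.2.2 _ (List.mem_map_of_mem this) _ (by simp) rfl
  rw [List.isChain_cons, List.isChain_append] at hc
  obtain ⟨h1, h2, -, h3⟩ := hc
  rcases List.eq_nil_or_concat' m with rfl | ⟨m, w, rfl⟩
  · have := hmem ⟨y.1, y.2.ne'⟩; simp at this
  have hw : w.1 = z.1 := h3 (Sum.inl w) (by simp) (Sum.inr z) (by simp)
  have hch : (x :: (m ++ [w]).map Subtype.val).IsChain G.Adj := by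
    rw [List.isChain_cons]
    refine ⟨?_, chain_map_inl.1 h2⟩
    intro v hv
    rcases m with _ | ⟨c, m⟩
    · have : w.1 = y.1 := h1 (Sum.inl w) (by simp)
      simp at hv; subst hv; rw [this]; exact y.2
    · have : c.1 = y.1 := h1 (Sum.inl c) (by simp)
      simp at hv; subst hv; rw [this]; exact y.2
  obtain ⟨p, hp⟩ := exists_walk_support_eq hch (a := x) (b := w.1) rfl
    (by rw [List.map_append, List.map_singleton, ← List.cons_append,
      List.getLast?_concat])
  refine hG _ p ?_ (hw ▸ z.2)
  refine Walk.IsPath.isHamiltonian_of_mem ?_ fun v => ?_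
  · rw [Walk.isPath_def, hp, List.nodup_cons]
    refine ⟨fun h => ?_, hmn.map Subtype.val_injective⟩
    obtain ⟨v, -, hv⟩ := List.mem_map.1 h
    exact v.2 hv
  · rw [hp, List.mem_cons]
    by_cases hv : v = x
    · exact Or.inl hv
    · exact Or.inr (List.mem_map.2 ⟨⟨v, hv⟩, hmem _, rfl⟩)


theorem exists_map_val {l : List V} (h : x ∉ l) :
    ∃ m : List {v : V // v ≠ x}, m.map Subtype.val = l :=
  ⟨l.attachWith _ fun v hv hvx => h (hvx ▸ hv), by simp⟩

/-- Reduces each missing edge to exhibiting one path with more than `|V|` of the `|V| + d` vertices,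
`d` being the degree of `x`. -/
theorem detourOrder_lt [Fintype V] [DecidableEq V]
    (hG : ∀ y (p : G.Walk x y), p.IsHamiltonian → ¬ G.Adj x y)
    {H : SimpleGraph ({v : V // v ≠ x} ⊕ {y : V // G.Adj x y})}
    {l : List ({v : V // v ≠ x} ⊕ {y : V // G.Adj x y})}
    (hc : l.IsChain H.Adj) (hn : l.Nodup) (hl : Fintype.card V < l.length) :
    detourOrder (splitVertex G x) < detourOrder H :=
  calc detourOrder (splitVertex G x) ≤ Fintype.card V := detourOrder_le fun _ => length_le_card hG
    _ < l.length := hl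
    _ ≤ detourOrder H := length_le_detourOrder (by rintro rfl; simp at hl) hc hn

/-- The part of a path starting at `x` that is left when `x` is removed. -/
theorem exists_arc {w : V} {p : G.Walk x w} (hp : p.IsPath) (hw : w ≠ x) :
    ∃ (m : List {v : V // v ≠ x}) (a : {v : V // v ≠ x}), (m.map Subtype.val).IsChain G.Adj ∧
      m.Nodup ∧ (∀ v, v ∈ m ↔ v.1 ∈ p.support) ∧ m.head? = some a ∧ G.Adj x a.1 ∧
      m.getLast? = some ⟨w, hw⟩ ∧ m.length = p.length := by
  cases p with
  | nil => exact (hw rfl).elim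
  | cons h q =>
    rw [Walk.cons_isPath_iff] at hp
    obtain ⟨m, hm⟩ := exists_map_val hp.2
    refine ⟨m, ⟨_, h.ne'⟩, hm ▸ q.isChain_adj_support, List.Nodup.of_map _ (hm ▸ hp.1.support_nodup),
      fun v => ?_, ?_, h, ?_, ?_⟩
    · rw [Walk.support_cons, List.mem_cons, ← hm]
      simp [v.2]
    · apply Option.map_injective Subtype.val_injective
      rw [← List.head?_map, hm, Walk.head?_support]; rfl
    · apply Option.map_injective Subtype.val_injective
      rw [← List.getLast?_map, hm, Walk.getLast?_support]; rfl
    · rw [← List.length_map (f := Subtype.val), hm]; simp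

theorem chain_map_inl_sup {l : List {v : V // v ≠ x}} (h : (l.map Subtype.val).IsChain G.Adj)
    (K : SimpleGraph ({v : V // v ≠ x} ⊕ {y : V // G.Adj x y})) :
    (l.map Sum.inl).IsChain (splitVertex G x ⊔ K).Adj :=
  (chain_map_inl.2 h).imp fun _ _ => Or.inl

/-- The Hamiltonian path has the form `u … y x z … v`. Cutting it at `x` and joining the pieces by
the new edge gives leaf of `z`, `z … v`, `u … y`, leaf of `y`: altogether `|V| + 1` vertices. -/
theorem lt_of_ne_of_ne [Fintype V] [DecidableEq V]
    (hG : ∀ y (p : G.Walk x y), p.IsHamiltonian → ¬ G.Adj x y)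
    {u v : {v : V // v ≠ x}} (huv : u ≠ v) {p : G.Walk u.1 v.1} (hp : p.IsHamiltonian) :
    detourOrder (splitVertex G x) <
      detourOrder (splitVertex G x ⊔ edge (Sum.inl u) (Sum.inl v)) := by
  obtain ⟨l₁, l₂, hl⟩ := List.append_of_mem (hp.mem_support x)
  have hn := hp.isPath.support_nodup
  have hc := p.isChain_adj_support
  have hhead := p.head?_support
  have hlast := p.getLast?_support
  have hlen := hp.length_support
  rw [hl] at hn hc hhead hlast hlen
  have hn' := List.nodup_middle.1 hn
  rw [List.nodup_cons, List.mem_append, not_or] at hn'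
  obtain ⟨m₁, rfl⟩ := exists_map_val hn'.1.1
  obtain ⟨m₂, rfl⟩ := exists_map_val hn'.1.2
  rw [← List.map_append] at hn'
  have hm := List.Nodup.of_map _ hn'.2
  rcases List.eq_nil_or_concat' m₁ with rfl | ⟨m₁', y, hy⟩
  · simp at hhead; exact (u.2 hhead.symm).elim
  rcases m₂ with _ | ⟨z, m₂⟩
  · simp at hlast; exact (v.2 hlast.symm).elim
  have hm₁ : m₁.head? = some u := by
    rcases m₁ with _ | ⟨a, m₁⟩
    · simp at hy
    · simpa [Subtype.ext_iff] using hhead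
  have hm₂ : (z :: m₂).getLast? = some v := by
    rcases List.eq_nil_or_concat' (z :: m₂) with h | ⟨m₂', b, h⟩
    · simp at h
    · rw [h] at hlast ⊢
      simpa [Subtype.ext_iff, List.getLast?_cons] using hlast
  rw [List.isChain_append, List.isChain_cons] at hc
  obtain ⟨hc₁, ⟨hxz, hc₂⟩, hyx⟩ := hc
  have hxy : G.Adj x y.1 := (hyx y.1 (by simp [hy]) x (by simp)).symm
  have hxz : G.Adj x z.1 := hxz z.1 (by simp)
  have hyz : y ≠ z := by
    rintro rfl
    rw [List.nodup_append] at hm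
    exact hm.2.2 y (by simp [hy]) y (by simp) rfl
  refine detourOrder_lt hG (l := Sum.inr ⟨z, hxz⟩ :: ((z :: m₂).map Sum.inl ++
    (m₁.map Sum.inl ++ [Sum.inr ⟨y, hxy⟩]))) ?_ ?_ ?_
  · rw [List.isChain_cons, List.isChain_append, List.isChain_append]
    refine ⟨?_, chain_map_inl_sup hc₂ _, ⟨chain_map_inl_sup hc₁ _, by simp, ?_⟩, ?_⟩
    · simp [splitVertex]
    · simp [hy, splitVertex]
    · rw [List.getLast?_map, hm₂]
      simp [hm₁, edge_adj, huv.symm]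
  · have := hm.map (f := Sum.inl (β := {y : V // G.Adj x y})) Sum.inl_injective
    rw [List.map_append, List.nodup_append_comm, List.nodup_append] at this
    rw [List.nodup_cons, List.nodup_append, List.nodup_append]
    refine ⟨?_, this.1, ⟨this.2.1, by simp, ?_⟩, ?_⟩
    · simp [Subtype.ext_iff, Subtype.coe_ne_coe.2 hyz.symm]
    · simp
    · intro a ha b hb
      rcases List.mem_append.1 hb with hb | hb
      · exact this.2.2 a ha b hb
      · obtain ⟨c, -, rfl⟩ := List.mem_map.1 ha
        simp at hb; simp [hb]
  · simp at hlen ⊢; omega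


/-- If the Hamiltonian path is `x a … v` with `a ≠ y`, then leaf of `a`, `a … v`, leaf of `y` is
long enough. -/
theorem lt_of_isHamiltonian_of_adj [Fintype V] [DecidableEq V]
    (hG : ∀ y (p : G.Walk x y), p.IsHamiltonian → ¬ G.Adj x y)
    {v : {v : V // v ≠ x}} {y : {y : V // G.Adj x y}} (hy : ∃ z, G.Adj x z ∧ z ≠ y.1)
    {p : G.Walk x v.1} (hp : p.IsHamiltonian) :
    detourOrder (splitVertex G x) <
      detourOrder (splitVertex G x ⊔ edge (Sum.inl v) (Sum.inr y)) := by
  obtain ⟨m, a, hc, hn, hmem, hhead, hxa, hlast, hlen⟩ := exists_arc hp.isPath v.2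
  have hlen' := hp.length_support
  rw [Walk.length_support, ← hlen] at hlen'
  by_cases hay : a.1 = y.1
  -- If `a = y`, that path would use the leaf of `y` twice. The path `y … v` is instead cut before
  -- another neighbour `z` of `x`: leaf of `z`, `z … v`, leaf of `y`, `y …` up to the predecessor of
  -- `z`.
  · obtain ⟨z, hxz, hzy⟩ := hy
    obtain ⟨m₁, m₂, rfl⟩ := List.append_of_mem
      ((hmem ⟨z, hxz.ne'⟩).2 (hp.mem_support z))
    have hhead₁ : m₁.head? = some a := by
      rcases m₁ with _ | ⟨b, m₁⟩
      · simp at hhead; exact (hzy (by rw [← hay, ← hhead])).elim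
      · simpa using hhead
    rw [List.map_append, List.isChain_append] at hc
    refine detourOrder_lt hG (l := Sum.inr ⟨z, hxz⟩ :: ((⟨z, hxz.ne'⟩ :: m₂).map Sum.inl ++
      (Sum.inr y :: m₁.map Sum.inl))) ?_ ?_ ?_
    · rw [List.isChain_cons, List.isChain_append, List.isChain_cons]
      refine ⟨by simp [splitVertex], chain_map_inl_sup hc.2.1 _,
        ⟨?_, chain_map_inl_sup hc.1 _⟩, ?_⟩
      · simp [hhead₁, splitVertex, hay]
      · rw [List.getLast?_append_of_ne_nil _ (by simp)] at hlast
        rw [List.getLast?_map, hlast]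
        simp [edge_adj]
    · have := hn.map (f := Sum.inl (β := {y : V // G.Adj x y})) Sum.inl_injective
      rw [List.map_append, List.nodup_append_comm] at this
      rw [List.nodup_cons, List.nodup_middle, List.nodup_cons]
      refine ⟨?_, ?_, this⟩
      · simp [Subtype.ext_iff, hzy]
      · simp
    · simp at hlen' ⊢; omega
  · refine detourOrder_lt hG (l := Sum.inr ⟨a, hxa⟩ :: (m.map Sum.inl ++ [Sum.inr y])) ?_ ?_ ?_
    · rw [List.isChain_cons, List.isChain_append]
      refine ⟨by simp [hhead, splitVertex], chain_map_inl_sup hc _, by simp, ?_⟩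
      rw [List.getLast?_map, hlast]
      simp [edge_adj]
    · rw [List.nodup_cons, List.nodup_append]
      refine ⟨by simp [Subtype.ext_iff, hay], hn.map Sum.inl_injective, by simp, by simp⟩
    · simp at hlen' ⊢; omega

/-- If `y`, `z`, `t` are the neighbours of `x`, a cycle missing only `y` runs from `z` to `t`. -/
theorem exists_arc_between [Fintype V] [DecidableEq V] {y z t : V} (hzy : z ≠ y)
    (hty : t ≠ y) (hzt : z ≠ t)
    (hz : G.Adj x z) (ht : G.Adj x t) (hxyzt : ∀ s, G.Adj x s → s = y ∨ s = z ∨ s = t)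
    {w : V} {p : G.Walk x w} (hp : p.IsPath) (hw : G.Adj x w) (hcov : ∀ v, v ∈ p.support ↔ v ≠ y) :
    ∃ m : List {v : V // v ≠ x}, (m.map Subtype.val).IsChain G.Adj ∧
      m.Nodup ∧ (∀ v, v ∈ m ↔ v.1 ≠ y) ∧ m.head? = some ⟨z, hz.ne'⟩ ∧
      m.getLast? = some ⟨t, ht.ne'⟩ ∧ m.length + 2 = Fintype.card V := by
  obtain ⟨m, a, hc, hn, hmem, hhead, hxa, hlast, hlen⟩ := exists_arc hp hw.ne'
  have hlen' : m.length + 2 = Fintype.card V := by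
    have h := List.toFinset_card_of_nodup hp.support_nodup
    have h' : p.support.toFinset = Finset.univ.erase y := by ext; simp [hcov]
    rw [h', Finset.card_erase_of_mem (Finset.mem_univ _), Finset.card_univ,
      Walk.length_support] at h
    omega
  have ha : a.1 ≠ y := (hcov _).1 ((hmem _).1 (List.mem_of_head? hhead))
  have hwy : w ≠ y := (hcov _).1 p.end_mem_support
  -- An arc with equal ends would be a single vertex, but it contains both `z` and `t`.
  have haw : a.1 ≠ w := by
    rintro rfl
    have hz' := (hmem ⟨z, hz.ne'⟩).2 ((hcov _).2 hzy)
    have ht' := (hmem ⟨t, ht.ne'⟩).2 ((hcov _).2 hty)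
    rcases m with _ | ⟨b, m⟩
    · simp at hhead
    · rcases List.eq_nil_or_concat' m with rfl | ⟨m, c, rfl⟩
      · simp at hz' ht'
        exact hzt (by rw [Subtype.ext_iff] at hz' ht'; exact hz'.trans ht'.symm)
      · simp [List.getLast?_cons] at hhead hlast
        rw [List.nodup_cons] at hn
        exact hn.1 (by simp [hhead, hlast])
  rcases hxyzt _ hxa with h | rfl | rfl
  · exact (ha h).elim
  · rcases hxyzt _ hw with h | h | rfl
    · exact (hwy h).elim
    · exact (haw h.symm).elim
    · exact ⟨m, hc, hn, fun v => (hmem v).trans (hcov _), hhead, hlast, hlen'⟩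
  · rcases hxyzt _ hw with h | rfl | h
    · exact (hwy h).elim
    · refine ⟨m.reverse, ?_, List.nodup_reverse.2 hn,
        fun v => List.mem_reverse.trans ((hmem v).trans (hcov _)), ?_, ?_, by simpa using hlen'⟩
      · rw [List.map_reverse, List.isChain_reverse]
        exact hc.imp fun _ _ h => h.symm
      · rw [List.head?_reverse, hlast]
      · rw [List.getLast?_reverse, hhead]
    · exact (haw h.symm).elim

/-- The cycle missing `y` leaves an arc `z … t` when `x` is removed. The path leaf of `y`, `y`, leaf
of `z`, `z … t`, leaf of `t` uses all `|V| + 2` vertices. -/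
theorem lt_of_adj_of_adj [Fintype V] [DecidableEq V]
    (hG : ∀ y (p : G.Walk x y), p.IsHamiltonian → ¬ G.Adj x y) {y z t : V} (hzy : z ≠ y)
    (hty : t ≠ y) (hzt : z ≠ t) (hy : G.Adj x y)
    (hz : G.Adj x z) (ht : G.Adj x t) (hxyzt : ∀ s, G.Adj x s → s = y ∨ s = z ∨ s = t)
    {w : V} {p : G.Walk x w} (hp : p.IsPath) (hw : G.Adj x w)
    (hcov : ∀ v, v ∈ p.support ↔ v ≠ y) :
    detourOrder (splitVertex G x) <
      detourOrder (splitVertex G x ⊔ edge (Sum.inl ⟨y, hy.ne'⟩) (Sum.inr ⟨z, hz⟩)) := by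
  obtain ⟨m, hc, hn, hmem, hhead, hlast, hlen⟩ :=
    exists_arc_between hzy hty hzt hz ht hxyzt hp hw hcov
  refine detourOrder_lt hG (l := Sum.inr ⟨y, hy⟩ :: Sum.inl ⟨y, hy.ne'⟩ :: Sum.inr ⟨z, hz⟩ ::
    (m.map Sum.inl ++ [Sum.inr ⟨t, ht⟩])) ?_ ?_ ?_
  · rw [List.isChain_cons, List.isChain_cons, List.isChain_cons, List.isChain_append]
    refine ⟨by simp [splitVertex], by simp [edge_adj], ?_, chain_map_inl_sup hc _, by simp, ?_⟩
    · simp [hhead, splitVertex]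
    · rw [List.getLast?_map, hlast]
      simp [splitVertex]
  · rw [List.nodup_cons, List.nodup_cons, List.nodup_cons, List.nodup_append]
    refine ⟨by simp [Subtype.ext_iff, hzy.symm, hty.symm], ?_, by simp [Subtype.ext_iff, hzt],
      hn.map Sum.inl_injective, by simp, by simp⟩
    have := (hmem ⟨y, hy.ne'⟩).not.2 (by simp)
    simpa using this
  · simp; omega

/-- On the arc `z … t` lies a neighbour `s` of `y`. The path leaf of `y`, `y`, `s … t`, leaf of `t`,
leaf of `z`, `z …` up to the predecessor of `s` uses all `|V| + 2` vertices. -/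
theorem lt_of_leaves [Fintype V] [DecidableEq V]
    (hG : ∀ y (p : G.Walk x y), p.IsHamiltonian → ¬ G.Adj x y) {y z t : V} (hzy : z ≠ y)
    (hty : t ≠ y) (hzt : z ≠ t) (hy : G.Adj x y)
    (hz : G.Adj x z) (ht : G.Adj x t) (hxyzt : ∀ s, G.Adj x s → s = y ∨ s = z ∨ s = t)
    {s : V} (hsx : s ≠ x) (hys : G.Adj y s)
    {w : V} {p : G.Walk x w} (hp : p.IsPath) (hw : G.Adj x w)
    (hcov : ∀ v, v ∈ p.support ↔ v ≠ y) :
    detourOrder (splitVertex G x) <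
      detourOrder (splitVertex G x ⊔ edge (Sum.inr ⟨z, hz⟩) (Sum.inr ⟨t, ht⟩)) := by
  obtain ⟨m, hc, hn, hmem, hhead, hlast, hlen⟩ :=
    exists_arc_between hzy hty hzt hz ht hxyzt hp hw hcov
  obtain ⟨m₁, m₂, rfl⟩ := List.append_of_mem ((hmem ⟨s, hsx⟩).2 hys.ne')
  have hy' := (hmem ⟨y, hy.ne'⟩).not.2 (by simp)
  rw [List.map_append, List.isChain_append] at hc
  rw [List.getLast?_append_of_ne_nil _ (by simp)] at hlast
  refine detourOrder_lt hG (l := Sum.inr ⟨y, hy⟩ :: Sum.inl ⟨y, hy.ne'⟩ ::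
    ((⟨s, hsx⟩ :: m₂).map Sum.inl ++
      (Sum.inr ⟨t, ht⟩ :: Sum.inr ⟨z, hz⟩ :: m₁.map Sum.inl))) ?_ ?_ ?_
  · rw [List.isChain_cons, List.isChain_cons, List.isChain_append, List.isChain_cons,
      List.isChain_cons]
    refine ⟨by simp [splitVertex], ?_, chain_map_inl_sup hc.2.1 _, ⟨?_, ?_,
      chain_map_inl_sup hc.1 _⟩, ?_⟩
    · simpa [splitVertex] using Or.inl hys
    · simp [edge_adj, Subtype.ext_iff, hzt.symm]
    · intro b hb
      rcases m₁ with _ | ⟨c, m₁⟩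
      · simp at hb
      · simp at hb hhead
        subst hb
        simp [hhead, splitVertex]
    · rw [List.getLast?_map, hlast]
      simp [splitVertex]
  · have := hn.map (f := Sum.inl (β := {y : V // G.Adj x y})) Sum.inl_injective
    rw [List.map_append, List.nodup_append_comm] at this
    rw [List.nodup_cons, List.nodup_cons, List.nodup_middle, List.nodup_cons, List.nodup_middle,
      List.nodup_cons]
    refine ⟨by simp [Subtype.ext_iff, hzy.symm, hty.symm], ?_,
      by simp [Subtype.ext_iff, hzt.symm], by simp, this⟩
    simp at hy' ⊢
    tauto
  · simp at hlen ⊢; omega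

/-- Splitting a vertex `x` of degree three of a maximally nonhamiltonian graph `G` gives a
detour-saturated graph if `G` has, for every neighbour `y` of `x`, a cycle missing only `y`. -/
theorem detourSaturated [Fintype V] [DecidableEq V]
    (hx : (G.neighborSet x).ncard = 3) (hG : ∀ y (p : G.Walk x y), p.IsHamiltonian → ¬ G.Adj x y)
    (hpath : ∀ u v, u ≠ v → ¬ G.Adj u v → ∃ p : G.Walk u v, p.IsHamiltonian)
    (hcycle : ∀ y, G.Adj x y → ∃ (w : V) (p : G.Walk x w), p.IsPath ∧ G.Adj x w ∧
      ∀ v, v ∈ p.support ↔ v ≠ y)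
    (hdeg : ∀ y, G.Adj x y → ∃ s, s ≠ x ∧ G.Adj y s) :
    DetourSaturated (splitVertex G x) := by
  -- Two neighbours of `x` determine the third; this is where degree three enters.
  have hthree : ∀ y z, G.Adj x y → G.Adj x z → y ≠ z →
      ∃ t, G.Adj x t ∧ t ≠ y ∧ t ≠ z ∧ ∀ s, G.Adj x s → s = y ∨ s = z ∨ s = t := by
    obtain ⟨a, b, c, hab, hac, hbc, h⟩ := Set.ncard_eq_three.1 hx
    have h' : ∀ s, G.Adj x s ↔ s = a ∨ s = b ∨ s = c := fun s => by
      rw [← mem_neighborSet, h]; simp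
    intro y z hy hz hyz
    simp only [h'] at hy hz ⊢
    rcases hy with rfl | rfl | rfl <;> rcases hz with rfl | rfl | rfl <;>
      first
      | exact (hyz rfl).elim
      | exact ⟨a, by simp, by assumption, by assumption, by tauto⟩
      | exact ⟨b, by simp, by tauto, by tauto, by tauto⟩
      | exact ⟨c, by simp, by tauto, by tauto, by tauto⟩
  have hmixed : ∀ (u : {v : V // v ≠ x}) (y : {y : V // G.Adj x y}), u.1 ≠ y.1 →
      detourOrder (splitVertex G x) <
        detourOrder (splitVertex G x ⊔ edge (Sum.inl u) (Sum.inr y)) := by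
    intro u y huy
    by_cases hu : G.Adj x u.1
    · obtain ⟨t, ht, htu, hty, hxt⟩ := hthree u.1 y.1 hu y.2 huy
      obtain ⟨w, p, hp, hw, hcov⟩ := hcycle u.1 hu
      exact lt_of_adj_of_adj hG huy.symm htu hty.symm hu y.2 ht hxt hp hw hcov
    · obtain ⟨p, hp⟩ := hpath x u.1 u.2.symm hu
      refine lt_of_isHamiltonian_of_adj hG ?_ hp
      have h1 : 1 < (G.neighborSet x).ncard := by omega
      obtain ⟨z, hz, hzy⟩ := Set.exists_ne_of_one_lt_ncard h1 y.1
      exact ⟨z, hz, hzy⟩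
  rintro (u | y) (v | z) hne hadj
  · have huv : u ≠ v := fun h => hne (by rw [h])
    obtain ⟨p, hp⟩ := hpath u.1 v.1 (Subtype.coe_ne_coe.2 huv) hadj
    exact lt_of_ne_of_ne hG huv hp
  · exact hmixed u z hadj
  · rw [edge_comm]; exact hmixed v y hadj
  · have hyz : y.1 ≠ z.1 := fun h => hne (by rw [Subtype.ext h])
    obtain ⟨t, ht, hty, htz, hxt⟩ := hthree y.1 z.1 y.2 z.2 hyz
    obtain ⟨w, p, hp, hw, hcov⟩ := hcycle t ht
    obtain ⟨s, hs, hts⟩ := hdeg t ht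
    exact lt_of_leaves hG hty.symm htz.symm hyz ht y.2 z.2
      (fun s hs => by rcases hxt s hs with h | h | h <;> simp [h]) hs hts hp hw hcov

end splitVertex

/-! ### Girth through nonbacktracking closed walks. -/

/-- The list of the ends of the nonbacktracking walks that start with `p`, `c` and make `n` further
steps, where `nb v` lists the neighbours of `v`. -/
def nonbacktrackEnds {B : Type*} [DecidableEq B] (nb : B → List B) : ℕ → B → B → List B
  | 0, _, c => [c]
  | n + 1, p, c => ((nb c).filter (· ≠ p)).flatMap (nonbacktrackEnds nb n c)

theorem mem_nonbacktrackEnds {B : Type*} [DecidableEq B] {nb : B → List B} {m : ℕ} {f : ℕ → B}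
    (hf : ∀ i < m, f (i + 1) ∈ nb (f i)) (hf' : ∀ i, i + 2 ≤ m → f (i + 2) ≠ f i)
    {n : ℕ} (i : ℕ) (hn : i + n + 1 ≤ m) :
    f (i + n + 1) ∈ nonbacktrackEnds nb n (f i) (f (i + 1)) := by
  induction n generalizing i with
  | zero => simp [nonbacktrackEnds]
  | succ n ih =>
    rw [nonbacktrackEnds, List.mem_flatMap]
    refine ⟨f (i + 2), ?_, ?_⟩
    · rw [List.mem_filter]
      exact ⟨hf _ (by omega), by simpa using hf' i (by omega)⟩
    · have := ih (i + 1) (by omega)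
      convert this using 2
      omega

theorem SimpleGraph.Walk.IsCycle.getVert_add_two_ne {V : Type*} {G : SimpleGraph V} {u : V}
    {p : G.Walk u u} (hp : p.IsCycle) {i : ℕ} (hi : i + 2 ≤ p.length) :
    p.getVert (i + 2) ≠ p.getVert i := by
  have := hp.getVert_sub_one_ne_getVert_add_one (i := i + 1) (by omega)
  simpa using this.symm

namespace splitVertex

variable {V : Type*} {G : SimpleGraph V} {x : V}

/-- The projection of the split graph onto `G` that glues the leaves together. -/
def proj (G : SimpleGraph V) (x : V) : splitVertex G x →g G where
  toFun := Sum.elim Subtype.val fun _ => x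
  map_rel' := by
    rintro (u | y) (v | z) h
    · exact h
    · change G.Adj u.1 x
      rw [show u.1 = z.1 from h]; exact z.2.symm
    · change G.Adj x v.1
      rw [show v.1 = y.1 from h]; exact y.2
    · exact h.elim

/-- Only leaves are identified by the projection, and two leaves with a common neighbour coincide.
Hence nonbacktracking walks stay nonbacktracking. -/
theorem proj_ne {a b c : {v : V // v ≠ x} ⊕ {y : V // G.Adj x y}}
    (hab : (splitVertex G x).Adj a b) (hbc : (splitVertex G x).Adj b c) (hca : c ≠ a) :
    proj G x c ≠ proj G x a := by
  intro h
  rcases a with a | a <;> rcases c with c | c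
  · exact hca (congrArg _ (Subtype.ext h))
  · exact a.2 h.symm
  · exact c.2 h
  · rcases b with b | b
    · have h1 : b.1 = a.1 := hab
      have h2 : b.1 = c.1 := hbc
      exact hca (congrArg _ (Subtype.ext (h2.symm.trans h1)))
    · exact hbc

/-- `hG` bounds the projections of all cycles from below; `l` lists an `n`-cycle of `G` that avoids
`x` and therefore survives the splitting. -/
theorem girth_eq {n : ℕ} (hn : 3 ≤ n)
    (hG : ∀ (f : ℕ → V) (m : ℕ), 0 < m → (∀ i < m, G.Adj (f i) (f (i + 1))) →
      (∀ i, i + 2 ≤ m → f (i + 2) ≠ f i) → f m = f 0 → n ≤ m)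
    {l : List V} (hl : l.length = n) (hx : x ∉ l) (hc : l.IsChain G.Adj) (hnd : l.Nodup)
    (hclose : ∀ a ∈ l.head?, ∀ b ∈ l.getLast?, G.Adj b a) :
    (splitVertex G x).girth = n := by
  have hlow : ∀ (a) (w : (splitVertex G x).Walk a a), w.IsCycle → n ≤ w.length := by
    intro a w hw
    refine hG (fun i => proj G x (w.getVert i)) w.length (by have := hw.three_le_length; omega)
      (fun i hi => (proj G x).map_adj (w.adj_getVert_succ hi)) (fun i hi => ?_) (by simp)
    exact proj_ne (w.adj_getVert_succ (by omega)) (w.adj_getVert_succ (by omega))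
      (hw.getVert_add_two_ne hi)
  obtain ⟨m, rfl⟩ := exists_map_val hx
  have hm : m.map Sum.inl ≠ ([] : List ({v : V // v ≠ x} ⊕ {y : V // G.Adj x y})) := by
    rintro h; simp at h; subst h; simp at hl; omega
  have hm' : m ≠ [] := by simpa using hm
  set p := Walk.ofSupport (m.map Sum.inl) hm (chain_map_inl.2 hc) with hp
  have hadj : (splitVertex G x).Adj ((m.map Sum.inl).getLast hm) ((m.map Sum.inl).head hm) := by
    rw [List.getLast_map, List.head_map]
    refine hclose _ ?_ _ ?_
    · rw [List.head?_map, List.head?_eq_some_head hm']; rfl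
    · rw [List.getLast?_map, List.getLast?_eq_some_getLast hm']; rfl
  have hlen : (Walk.cons hadj p).length = n := by
    rw [Walk.length_cons, hp, Walk.length_ofSupport]
    simp at hl ⊢; omega
  have hcyc : (Walk.cons hadj p).IsCycle := by
    rw [Walk.isCycle_iff_isPath_tail_and_le_length, hlen]
    refine ⟨?_, hn⟩
    rw [Walk.isPath_def]
    have : (Walk.cons hadj p).tail.support = p.support := by simp
    rw [this, hp, Walk.support_ofSupport]
    exact (List.Nodup.of_map _ hnd).map Sum.inl_injective
  refine le_antisymm (hlen ▸ girth_le_length hcyc) ?_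
  obtain ⟨a, w, hw, h⟩ := exists_girth_eq_length.2 fun h => h _ hcyc
  rw [h]; exact hlow a w hw

theorem card_eq [Fintype V] [DecidableEq V] (hx : (G.neighborSet x).ncard = 3) :
    Nat.card ({v : V // v ≠ x} ⊕ {y : V // G.Adj x y}) = Fintype.card V + 2 := by
  have h1 : Nat.card {y : V // G.Adj x y} = 3 := hx
  have h2 : 0 < Fintype.card V := Fintype.card_pos_iff.2 ⟨x⟩
  rw [Nat.card_sum, h1, Nat.card_eq_fintype_card, Fintype.card_subtype_compl,
    Fintype.card_subtype_eq]
  omega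

end splitVertex

/-! ### Isaacs' graphs: adjacency, degree and girth. -/

namespace isaacsGraph

variable {k : ℕ}

/-- In `Fin 4` negation fixes 0 and 2 and exchanges 1 and 3, which is exactly the twist between
consecutive columns. -/
theorem adj_iff (hk : 1 < k) {a b : ZMod k × Fin 4} :
    (isaacsGraph k).Adj a b ↔ (b.1 = a.1 ∧ (a.2 = 0 ↔ b.2 ≠ 0)) ∨
      (a.2 ≠ 0 ∧ b.2 = -a.2 ∧ (b.1 = a.1 + 1 ∨ a.1 = b.1 + 1)) := by
  have : Fact (1 < k) := ⟨hk⟩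
  obtain ⟨i, r⟩ := a
  obtain ⟨j, s⟩ := b
  have h1 : ∀ j : ZMod k, j ≠ j + 1 := fun j h => by simp at h
  simp only [isaacsGraph, fromRel_adj, ne_eq, Prod.mk.injEq, not_and]
  constructor
  · rintro ⟨hne, h⟩
    revert hne h
    fin_cases r <;> fin_cases s <;> simp <;> grind
  · intro h
    refine ⟨?_, ?_⟩
    · rintro rfl rfl
      revert h
      fin_cases r <;> simp [h1]
    · revert h
      fin_cases r <;> fin_cases s <;> simp <;> grind

/-- The neighbours of a vertex in the strip that covers Isaacs' graphs. -/
def coverNeighbors (v : ℤ × Fin 4) : List (ℤ × Fin 4) :=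
  if v.2 = 0 then [(v.1, 1), (v.1, 2), (v.1, 3)]
  else [(v.1, 0), (v.1 + 1, -v.2), (v.1 - 1, -v.2)]

theorem notMem_nonbacktrackEnds : ∀ r, ∀ c ∈ coverNeighbors (0, r), ∀ n < 5,
    ((0, r) : ℤ × Fin 4) ∉ nonbacktrackEnds coverNeighbors n (0, r) c := by
  decide +kernel

theorem exists_shift (hk : 1 < k) {a b : ZMod k × Fin 4} (h : (isaacsGraph k).Adj a b) :
    ∃ d : ℤ, |d| ≤ 1 ∧ b.1 = a.1 + d ∧ ∀ z : ℤ, (z + d, b.2) ∈ coverNeighbors (z, a.2) := by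
  rcases (adj_iff hk).1 h with ⟨h1, h2⟩ | ⟨h1, h2, h3 | h3⟩
  · refine ⟨0, by simp, by simp [h1], fun z => ?_⟩
    by_cases ha : a.2 = 0
    · have := h2.1 ha
      generalize b.2 = s at this
      fin_cases s <;> simp_all [coverNeighbors]
    · have : b.2 = 0 := by tauto
      simp [coverNeighbors, ha, this]
  · exact ⟨1, by simp, by simp [h3], fun z => by simp [coverNeighbors, h1, h2]⟩
  · exact ⟨-1, by simp, by simp [h3], fun z => by simp [coverNeighbors, h1, h2]; omega⟩

/-- The walk lifts to the infinite strip over `ℤ`. Its total shift is divisible by `k` and has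
absolute value at most `m < 6 ≤ k`, so it vanishes and the lift is closed too. The finite check
`notMem_nonbacktrackEnds` excludes this. -/
theorem six_le_of_closed (hk : 6 ≤ k) (f : ℕ → ZMod k × Fin 4) (m : ℕ) (hm : 0 < m)
    (hadj : ∀ i < m, (isaacsGraph k).Adj (f i) (f (i + 1)))
    (hf : ∀ i, i + 2 ≤ m → f (i + 2) ≠ f i) (hclose : f m = f 0) : 6 ≤ m := by
  by_contra! hlt
  have hd : ∀ i, ∃ d : ℤ, i < m → |d| ≤ 1 ∧ (f (i + 1)).1 = (f i).1 + d ∧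
      ∀ z : ℤ, (z + d, (f (i + 1)).2) ∈ coverNeighbors (z, (f i).2) := by
    intro i
    by_cases hi : i < m
    · obtain ⟨d, hd⟩ := exists_shift (by omega) (hadj i hi)
      exact ⟨d, fun _ => hd⟩
    · exact ⟨0, fun h => (hi h).elim⟩
  choose d hd using hd
  let g : ℕ → ℤ × Fin 4 := fun i => (∑ j ∈ Finset.range i, d j, (f i).2)
  have hg : ∀ i ≤ m, (f i).1 = (f 0).1 + ((g i).1 : ℤ) := by
    intro i hi
    induction i with
    | zero => simp [g]
    | succ i ih =>
      rw [(hd i (by omega)).2.1, ih (by omega)]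
      simp only [g, Finset.sum_range_succ, Int.cast_add]
      ring
  have hgabs : |(g m).1| ≤ m := by
    have h : (g m).1 = ∑ j ∈ Finset.range m, d j := rfl
    rw [h]
    calc |∑ j ∈ Finset.range m, d j| ≤ ∑ j ∈ Finset.range m, |d j| := Finset.abs_sum_le_sum_abs _ _
      _ ≤ ∑ j ∈ Finset.range m, (1 : ℤ) :=
        Finset.sum_le_sum fun j hj => (hd j (Finset.mem_range.1 hj)).1
      _ = m := by simp
  have hgm : (g m).1 = 0 := by
    have h := hg m le_rfl
    rw [hclose, left_eq_add, ZMod.intCast_zmod_eq_zero_iff_dvd] at h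
    exact Int.eq_zero_of_abs_lt_dvd h (hgabs.trans_lt (by exact_mod_cast hlt.trans_le hk))
  have hgclose : g m = (0, (f 0).2) := Prod.ext hgm (by simp [g, hclose])
  have hnb : ∀ i < m, g (i + 1) ∈ coverNeighbors (g i) := by
    intro i hi
    have := (hd i hi).2.2 (g i).1
    simpa [g, Finset.sum_range_succ] using this
  have hmem := mem_nonbacktrackEnds hnb (fun i hi h => hf i hi ?_) (n := m - 1) 0 (by omega)
  · rw [show 0 + (m - 1) + 1 = m by omega, hgclose] at hmem
    refine notMem_nonbacktrackEnds (f 0).2 (g 1) ?_ (m - 1) (by omega) ?_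
    · simpa [g] using hnb 0 hm
    · simpa [g] using hmem
  · refine Prod.ext ?_ (by simpa [g] using congrArg Prod.snd h)
    rw [hg _ hi, hg i (by omega), h]

theorem neighborSet_ncard (hk : 2 < k) (x : ZMod k × Fin 4) :
    ((isaacsGraph k).neighborSet x).ncard = 3 := by
  have : Fact (2 < k) := ⟨hk⟩
  rw [Set.ncard_eq_three]
  have h2 : (2 : ZMod k) ≠ 0 := by
    have : ((2 : ℕ) : ZMod k) ≠ 0 := by
      rw [Ne, ZMod.natCast_eq_zero_iff]
      exact fun h => absurd (Nat.le_of_dvd two_pos h) (by omega)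
    simpa using this
  by_cases hx : x.2 = 0
  · refine ⟨(x.1, 1), (x.1, 2), (x.1, 3), by simp, by simp, by simp, ?_⟩
    ext ⟨j, s⟩
    simp only [mem_neighborSet, adj_iff (show 1 < k by omega), hx]
    fin_cases s <;> simp
  · refine ⟨(x.1, 0), (x.1 + 1, -x.2), (x.1 - 1, -x.2), by simp [hx, eq_comm], by simp [hx, eq_comm], ?_, ?_⟩
    · intro h
      apply h2
      have := congrArg Prod.fst h
      simp only at this
      linear_combination this
    · ext ⟨j, s⟩
      simp only [mem_neighborSet, adj_iff (show 1 < k by omega), hx]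
      simp [eq_sub_iff_add_eq, eq_comm]
      tauto

theorem girth_splitVertex (hk : 6 ≤ k) (x : ZMod k × Fin 4) :
    (splitVertex (isaacsGraph k) x).girth = 6 := by
  have : Fact (2 < k) := ⟨by omega⟩
  obtain ⟨j, r⟩ := x
  have h1 : (1 : ZMod k) ≠ 0 := by
    have : ((1 : ℕ) : ZMod k) ≠ 0 := by
      rw [Ne, ZMod.natCast_eq_zero_iff]
      exact fun h => absurd (Nat.le_of_dvd one_pos h) (by omega)
    simpa using this
  have h2 : (1 + 1 : ZMod k) ≠ 0 := by
    have : ((2 : ℕ) : ZMod k) ≠ 0 := by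
      rw [Ne, ZMod.natCast_eq_zero_iff]
      exact fun h => absurd (Nat.le_of_dvd two_pos h) (by omega)
    norm_num; simpa using this
  -- A hexagon in the columns `j + 1` and `j + 2`, away from the column `j` of the split vertex.
  refine splitVertex.girth_eq (by norm_num) (six_le_of_closed hk)
    (l := [(j + 1, 0), (j + 1, 1), (j + 1 + 1, 3), (j + 1 + 1, 0), (j + 1 + 1, 2), (j + 1, 2)])
    rfl ?_ ?_ ?_ ?_
  · simp [h1, h2, add_assoc]
  · simp [adj_iff (show 1 < k by omega)]; decide
  · simp [h1]
  · simp [adj_iff (show 1 < k by omega)]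

theorem exists_adj_ne (hk : 2 < k) {x y : ZMod k × Fin 4} :
    ∃ s, s ≠ x ∧ (isaacsGraph k).Adj y s := by
  have h : 1 < ((isaacsGraph k).neighborSet y).ncard := by rw [neighborSet_ncard hk]; omega
  obtain ⟨s, hs, hsx⟩ := Set.exists_ne_of_one_lt_ncard h x
  exact ⟨s, hsx, hs⟩

end isaacsGraph

/-! ### Walks recorded by their length and the vertices they cover. -/

/-- There is a walk of length `n` from `u` to `v` that visits all vertices of `s`. -/
def SimpleGraph.Joins {V : Type*} (G : SimpleGraph V) (u v : V) (n : ℕ) (s : Set V) : Prop :=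
  ∃ w : G.Walk u v, w.length = n ∧ ∀ x ∈ s, x ∈ w.support

namespace SimpleGraph.Joins

variable {V W : Type*} {G : SimpleGraph V} {H : SimpleGraph W} {u v w : V} {n m : ℕ} {s t : Set V}

theorem nil (u : V) : G.Joins u u 0 {u} := ⟨.nil, rfl, by simp⟩

theorem cons (h : G.Adj u v) : G.Joins v w n s → G.Joins u w (n + 1) (insert u s) := by
  rintro ⟨p, rfl, hp⟩
  refine ⟨.cons h p, rfl, ?_⟩
  rintro x (rfl | hx)
  · simp
  · simp [hp x hx]

theorem trans : G.Joins u v n s → G.Joins v w m t → G.Joins u w (n + m) (s ∪ t) := by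
  rintro ⟨p, rfl, hp⟩ ⟨q, rfl, hq⟩
  refine ⟨p.append q, by simp, ?_⟩
  rintro x (hx | hx)
  · exact (Walk.mem_support_append_iff _ _).2 (.inl (hp x hx))
  · exact (Walk.mem_support_append_iff _ _).2 (.inr (hq x hx))

theorem symm : G.Joins u v n s → G.Joins v u n s := by
  rintro ⟨p, rfl, hp⟩
  exact ⟨p.reverse, by simp, by simpa using hp⟩

theorem map (f : G →g H) : G.Joins u v n s → H.Joins (f u) (f v) n (f '' s) := by
  rintro ⟨p, rfl, hp⟩
  refine ⟨p.map f, by simp, ?_⟩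
  rintro _ ⟨x, hx, rfl⟩
  rw [Walk.support_map]
  exact List.mem_map_of_mem (hp x hx)

theorem mono (hst : t ⊆ s) : G.Joins u v n s → G.Joins u v n t := by
  rintro ⟨p, hn, hp⟩
  exact ⟨p, hn, fun x hx => hp x (hst hx)⟩

theorem adj (h : G.Adj u v) : G.Joins u v 1 ∅ := ⟨h.toWalk, by simp, by simp⟩

/-- A walk with `|V| - 1` steps that meets all vertices cannot repeat any. Thus pieces may be
concatenated without checking disjointness: lengths and coverage suffice. -/
theorem exists_isHamiltonian [Fintype V] [DecidableEq V] (h : G.Joins u v n s)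
    (hn : n + 1 = Fintype.card V) (hs : ∀ x, x ∈ s) : ∃ p : G.Walk u v, p.IsHamiltonian := by
  obtain ⟨p, rfl, hp⟩ := h
  refine ⟨p, Walk.IsPath.isHamiltonian_of_mem ?_ fun x => hp x (hs x)⟩
  rw [Walk.isPath_def, ← Multiset.coe_nodup, ← Multiset.toFinset_card_eq_card_iff_nodup]
  have : (p.support : Multiset V).toFinset = Finset.univ := by
    ext x; simpa using hp x (hs x)
  rw [this, Finset.card_univ, ← hn]
  simp

end SimpleGraph.Joins

/-! ### Strands in the strip and Hamiltonian paths of `J_k`. -/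

namespace isaacsGraph

variable {k : ℕ}

/-- The strip that covers Isaacs' graphs, with the twists undone: the columns are numbered by
`ℕ`, a column consists of a centre `(j, 0)` joined to `(j, 1)`, `(j, 2)`, `(j, 3)`, and `(j, r)` is
joined to `(j + 1, r)` for `r = 1, 2, 3`. -/
def strip : SimpleGraph (ℕ × Fin 4) where
  Adj a b := (b.1 = a.1 ∧ (a.2 = 0 ↔ b.2 ≠ 0)) ∨
    (a.2 ≠ 0 ∧ b.2 = a.2 ∧ (b.1 = a.1 + 1 ∨ a.1 = b.1 + 1))
  symm := ⟨by
    rintro a b (⟨h1, h2⟩ | ⟨h1, h2, h3⟩)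
    · exact Or.inl ⟨h1.symm, by tauto⟩
    · exact Or.inr ⟨h2 ▸ h1, h2.symm, h3.symm⟩⟩
  loopless := ⟨by
    rintro a (⟨_, h⟩ | ⟨_, _, h⟩)
    · tauto
    · omega⟩

theorem strip_adj_succ {c : ℕ} {r : Fin 4} (hr : r ≠ 0) : strip.Adj (c, r) (c + 1, r) :=
  Or.inr ⟨hr, rfl, Or.inl rfl⟩

theorem strip_adj_pred {c : ℕ} {r : Fin 4} (hr : r ≠ 0) : strip.Adj (c + 1, r) (c, r) :=
  (strip_adj_succ hr).symm

theorem strip_adj_zero {c : ℕ} {r : Fin 4} (hr : r ≠ 0) : strip.Adj (c, r) (c, 0) :=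
  Or.inl ⟨rfl, by simp [hr]⟩

theorem strip_zero_adj {c : ℕ} {r : Fin 4} (hr : r ≠ 0) : strip.Adj (c, 0) (c, r) :=
  (strip_adj_zero hr).symm

/-- The `m` columns following column `c`. -/
def columns (c m : ℕ) : Set (ℕ × Fin 4) := {v | c < v.1 ∧ v.1 ≤ c + m}

/-- A strand from column `c` to column `c + 2 * n` that covers all columns after `c`. -/
def OneStrand (n : ℕ) (r s : Fin 4) : Prop :=
  ∀ c, strip.Joins (c, r) (c + 2 * n, s) (8 * n) (columns c (2 * n))

theorem OneStrand.zero (r : Fin 4) : OneStrand 0 r r := fun c =>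
  (Joins.nil _).mono fun v hv => by simp [columns] at hv; omega

theorem OneStrand.trans {n m : ℕ} {r s t : Fin 4} (h : OneStrand n r s) (h' : OneStrand m s t) :
    OneStrand (n + m) r t := by
  intro c
  have := (h c).trans (h' (c + 2 * n))
  rw [show c + 2 * (n + m) = c + 2 * n + 2 * m by ring, show 8 * (n + m) = 8 * n + 8 * m by ring]
  refine this.mono fun v hv => ?_
  simp only [columns, Set.mem_ofPred_eq, Set.mem_union] at hv ⊢
  omega

theorem exists_third : ∀ r s : Fin 4, ∃ t, t ≠ 0 ∧ t ≠ r ∧ t ≠ s := by decide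

theorem eq_or_eq (r s t : Fin 4) (hr : r ≠ 0) (hs : s ≠ 0) (ht : t ≠ 0) (hrs : r ≠ s)
    (hrt : r ≠ t) (hst : s ≠ t) (a : Fin 4) : a = 0 ∨ a = r ∨ a = s ∨ a = t := by
  have : ∀ r s t a : Fin 4, r ≠ 0 ∧ s ≠ 0 ∧ t ≠ 0 ∧ r ≠ s ∧ r ≠ t ∧ s ≠ t →
    a = 0 ∨ a = r ∨ a = s ∨ a = t := by decide
  exact this r s t a ⟨hr, hs, ht, hrs, hrt, hst⟩

/-- Out on track `r`, through the far centre, back on the third track `t`, through the near centre,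
out on `s`. The tracks must differ; with four or more columns this restriction disappears
(`OneStrand.of_two_le`). -/
theorem OneStrand.one {r s : Fin 4} (hr : r ≠ 0) (hs : s ≠ 0) (hrs : r ≠ s) :
    OneStrand 1 r s := by
  intro c
  obtain ⟨t, ht, htr, hts⟩ := exists_third r s
  have h : strip.Joins (c, r) (c + 2, s) 8 _ :=
    .cons (strip_adj_succ hr) <| .cons (strip_adj_succ hr) <| .cons (strip_adj_zero hr) <|
    .cons (strip_zero_adj ht) <| .cons (strip_adj_pred ht) <| .cons (strip_adj_zero ht) <|
    .cons (strip_zero_adj hs) <| .cons (strip_adj_succ hs) <| .nil _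
  refine h.mono ?_
  rintro ⟨j, a⟩ hv
  obtain rfl | rfl : j = c + 1 ∨ j = c + 2 := by simp [columns] at hv; omega
  all_goals
    rcases eq_or_eq r s t hr hs ht hrs htr.symm hts.symm a with rfl | rfl | rfl | rfl <;> simp

theorem OneStrand.of_ne {n : ℕ} (hn : 1 ≤ n) {r s : Fin 4} (hr : r ≠ 0) (hs : s ≠ 0)
    (hrs : r ≠ s) : OneStrand n r s := by
  induction n, hn using Nat.le_induction generalizing r with
  | base => exact .one hr hs hrs
  | succ n hn ih =>
    obtain ⟨t, ht, htr, hts⟩ := exists_third r s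
    rw [add_comm]
    exact (OneStrand.one hr ht htr.symm).trans (ih ht hts)

theorem OneStrand.of_two_le {n : ℕ} (hn : 2 ≤ n) {r s : Fin 4} (hr : r ≠ 0) (hs : s ≠ 0) :
    OneStrand n r s := by
  obtain ⟨n, rfl⟩ := Nat.exists_eq_add_of_le hn
  obtain ⟨t, ht, htr, hts⟩ := exists_third r s
  have := (OneStrand.one hr ht htr.symm).trans (OneStrand.of_ne (n := n + 1) (by omega) ht hs hts)
  rwa [show 1 + (n + 1) = 2 + n by ring] at this

/-- Two disjoint strands from column `c` to column `c + m` that together cover all columns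
after `c`. -/
def TwoStrands (m : ℕ) (a b a' b' : Fin 4) : Prop :=
  ∀ c, ∃ n₁ n₂ s₁ s₂, strip.Joins (c, a) (c + m, a') n₁ s₁ ∧ strip.Joins (c, b) (c + m, b') n₂ s₂ ∧
    n₁ + n₂ = 4 * m ∧ columns c m ⊆ s₁ ∪ s₂

theorem TwoStrands.zero (a b : Fin 4) : TwoStrands 0 a b a b := fun c =>
  ⟨0, 0, _, _, .nil _, .nil _, rfl, fun v hv => by simp [columns] at hv; omega⟩

theorem TwoStrands.swap {m : ℕ} {a b a' b' : Fin 4} (h : TwoStrands m a b a' b') :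
    TwoStrands m b a b' a' := by
  intro c
  obtain ⟨n₁, n₂, s₁, s₂, h₁, h₂, hn, hs⟩ := h c
  exact ⟨n₂, n₁, s₂, s₁, h₂, h₁, by omega, by rwa [Set.union_comm]⟩

theorem TwoStrands.trans {m m' : ℕ} {a b a' b' a'' b'' : Fin 4} (h : TwoStrands m a b a' b')
    (h' : TwoStrands m' a' b' a'' b'') : TwoStrands (m + m') a b a'' b'' := by
  intro c
  obtain ⟨n₁, n₂, s₁, s₂, h₁, h₂, hn, hs⟩ := h c
  obtain ⟨n₁', n₂', s₁', s₂', h₁', h₂', hn', hs'⟩ := h' (c + m)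
  rw [← add_assoc]
  refine ⟨_, _, _, _, h₁.trans h₁', h₂.trans h₂', by omega, fun v hv => ?_⟩
  simp only [columns, Set.mem_ofPred_eq] at hv
  by_cases hv' : v.1 ≤ c + m
  · rcases hs ⟨hv.1, hv'⟩ with h | h <;> simp [h]
  · rcases hs' (show v ∈ columns (c + m) m' from ⟨by omega, by omega⟩) with h | h <;> simp [h]

/-- One strand passes through the centre to the free track `v`, the other goes straight on. Each
column thus acts as a transposition of tracks, so the parity of the number of columns fixes the
parity of the permutation. -/
theorem TwoStrands.one {a b v : Fin 4} (ha : a ≠ 0) (hb : b ≠ 0) (hv : v ≠ 0) (hab : a ≠ b)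
    (hav : a ≠ v) (hbv : b ≠ v) : TwoStrands 1 a b v b := by
  intro c
  refine ⟨3, 1, _, _, .cons (strip_adj_succ ha) <| .cons (strip_adj_zero ha) <|
    .cons (strip_zero_adj hv) <| .nil _, .cons (strip_adj_succ hb) <| .nil _, rfl, ?_⟩
  rintro ⟨j, d⟩ hd
  obtain rfl : j = c + 1 := by simp [columns] at hd; omega
  rcases eq_or_eq a b v ha hb hv hab hav hbv d with rfl | rfl | rfl | rfl <;> simp

theorem TwoStrands.one_or {a b a' b' : Fin 4} (ha : a ≠ 0) (hb : b ≠ 0) (ha' : a' ≠ 0) (hb' : b' ≠ 0)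
    (hab : a ≠ b) (hab' : a' ≠ b') (h : a' ≠ a ∧ b' = b ∨ a' = a ∧ b' ≠ b) :
    TwoStrands 1 a b a' b' := by
  rcases h with ⟨h, rfl⟩ | ⟨rfl, h⟩
  · exact .one ha hb ha' hab h.symm hab'.symm
  · exact (TwoStrands.one hb ha hb' hab.symm h.symm hab').swap

theorem TwoStrands.refl_two {a b : Fin 4} (ha : a ≠ 0) (hb : b ≠ 0) (hab : a ≠ b) (n : ℕ) :
    TwoStrands (2 * n) a b a b := by
  induction n with
  | zero => exact .zero a b
  | succ n ih =>
    obtain ⟨v, hv, hva, hvb⟩ := exists_third a b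
    exact ih.trans ((TwoStrands.one ha hb hv hab hva.symm hvb.symm).trans
      (TwoStrands.one hv hb ha hvb hva hab.symm))

/-- For an odd number of columns at least three all odd permutations of the tracks occur. -/
theorem TwoStrands.of_odd {m : ℕ} (hm : Odd m) (hm' : 3 ≤ m) {a b a' b' : Fin 4} (ha : a ≠ 0)
    (hb : b ≠ 0) (ha' : a' ≠ 0) (hb' : b' ≠ 0) (hab : a ≠ b) (hab' : a' ≠ b')
    (h : a' ≠ a ∧ b' = b ∨ a' = a ∧ b' ≠ b ∨ a' = b ∧ b' = a) : TwoStrands m a b a' b' := by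
  obtain ⟨n, rfl⟩ := hm
  rw [← or_assoc] at h
  rcases h with h | ⟨rfl, rfl⟩
  · exact (TwoStrands.refl_two ha hb hab n).trans (.one_or ha hb ha' hb' hab hab' h)
  · obtain ⟨n, rfl⟩ : ∃ l, n = l + 1 := ⟨n - 1, by omega⟩
    obtain ⟨v, hv, hva, hvb⟩ := exists_third a' b'
    have := (TwoStrands.refl_two ha hb hab n).trans <|
      (TwoStrands.one_or ha hb hv hb hab hva (Or.inl ⟨hvb, rfl⟩)).trans <|
      (TwoStrands.one_or hv hb hv ha hva hvb (Or.inr ⟨rfl, hab⟩)).trans <|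
      (TwoStrands.one_or hv ha hb ha hvb hab.symm (Or.inl ⟨hva.symm, rfl⟩))
    rwa [show 2 * n + (1 + (1 + 1)) = 2 * (n + 1) + 1 by ring] at this

/-- For an even number of columns at least two all even permutations of the tracks occur. -/
theorem TwoStrands.of_even {m : ℕ} (hm : Even m) (hm' : 2 ≤ m) {a b a' b' : Fin 4} (ha : a ≠ 0)
    (hb : b ≠ 0) (ha' : a' ≠ 0) (hb' : b' ≠ 0) (hab : a ≠ b)
    (h : a' = a ∧ b' = b ∨ a' = b ∧ b' ≠ a ∧ b' ≠ b ∨ b' = a ∧ a' ≠ a ∧ a' ≠ b) :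
    TwoStrands m a b a' b' := by
  obtain ⟨n, rfl⟩ := hm
  obtain ⟨n, rfl⟩ : ∃ l, n = l + 1 := ⟨n - 1, by omega⟩
  rw [show n + 1 + (n + 1) = 2 * n + (1 + 1) by ring]
  rcases h with ⟨rfl, rfl⟩ | ⟨rfl, h, h'⟩ | ⟨rfl, h, h'⟩
  · exact TwoStrands.refl_two ha hb hab (n + 1)
  · exact (TwoStrands.refl_two ha hb hab n).trans <|
      (TwoStrands.one_or ha hb ha hb' hab h.symm (Or.inr ⟨rfl, h'⟩)).trans <|
      (TwoStrands.one_or ha hb' hb hb' h.symm h'.symm (Or.inl ⟨hab.symm, rfl⟩))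
  · exact (TwoStrands.refl_two ha hb hab n).trans <|
      (TwoStrands.one_or ha hb ha' hb hab h' (Or.inl ⟨h, rfl⟩)).trans <|
      (TwoStrands.one_or ha' hb ha' ha h' h (Or.inr ⟨rfl, hab⟩))


/-- The tracks of column `j` in the untwisted strip. -/
def twist (j : ℕ) (r : Fin 4) : Fin 4 := if Even j then r else -r

theorem twist_twist (j : ℕ) (r : Fin 4) : twist j (twist j r) = r := by
  unfold twist; split_ifs <;> simp

theorem twist_eq_zero {j : ℕ} {r : Fin 4} : twist j r = 0 ↔ r = 0 := by
  unfold twist; split_ifs <;> simp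

theorem twist_succ (j : ℕ) (r : Fin 4) : twist (j + 1) r = -twist j r := by
  unfold twist; simp only [Nat.even_add_one]; split_ifs <;> simp

/-- The covering of `J_k` by the strip. -/
def cover (hk : 1 < k) : strip →g isaacsGraph k where
  toFun v := (v.1, twist v.1 v.2)
  map_rel' := by
    rintro ⟨i, r⟩ ⟨j, s⟩ h
    rw [adj_iff hk]
    simp only [twist_eq_zero, ne_eq]
    rcases h with ⟨h1, h2⟩ | ⟨h1, h2, h3 | h3⟩
    · simp only at h1 h2; subst h1; exact Or.inl ⟨rfl, h2⟩
    · simp only at h1 h2 h3; subst h2 h3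
      exact Or.inr ⟨h1, twist_succ _ _, Or.inl (by simp)⟩
    · simp only at h1 h2 h3; subst h2 h3
      exact Or.inr ⟨h1, by rw [twist_succ, neg_neg], Or.inr (by simp)⟩

theorem cover_apply (hk : 1 < k) (j : ℕ) (r : Fin 4) : cover hk (j, r) = ((j : ZMod k), twist j r) :=
  rfl

/-- One turn around an odd number of columns leaves a single twist; this explains the signs in the
targets `-f`, `-g` below. -/
theorem cover_wrap (hk : 1 < k) (hodd : Odd k) (r : Fin 4) : cover hk (k, -r) = cover hk (0, r) := by
  simp [cover_apply, twist, Nat.not_even_iff_odd.2 hodd]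

theorem exists_cover (hk : 1 < k) (x : ZMod k × Fin 4) : ∃ j < k, ∃ r, cover hk (j, r) = x := by
  have : NeZero k := ⟨by omega⟩
  exact ⟨x.1.val, ZMod.val_lt _, twist x.1.val x.2,
    Prod.ext (ZMod.natCast_zmod_val _) (twist_twist _ _)⟩

theorem exists_isHamiltonian_of_joins [NeZero k] (hk : 1 < k) {u v : ZMod k × Fin 4} {n : ℕ}
    {s : Set (ZMod k × Fin 4)} (h : (isaacsGraph k).Joins u v n s) (hn : n + 1 = 4 * k)
    (hs : ∀ j < k, ∀ r, cover hk (j, r) ∈ s) :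
    ∃ p : (isaacsGraph k).Walk u v, p.IsHamiltonian := by
  refine h.exists_isHamiltonian (by simp [hn, ZMod.card, mul_comm]) fun x => ?_
  obtain ⟨j, hj, r, rfl⟩ := exists_cover hk x
  exact hs j hj r

/-- The basic shape of a Hamiltonian path of `J_k`: a single strand leads from the columns
`0, …, c` to the columns `c + 2 * n + 1, …, d`, and two strands lead back. -/
theorem exists_isHamiltonian_of_strands [NeZero k] (hk : 1 < k) (hodd : Odd k) {c d n m : ℕ}
    (hkd : k = d + m + 1) {u v : ℕ × Fin 4} {p p' q q' f g : Fin 4}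
    {nA nB nC nD : ℕ} {sA sB sC sD : Set (ℕ × Fin 4)} (hp' : p' ≠ 0) (hf : f ≠ 0) (hg : g ≠ 0)
    (hA : strip.Joins u (c, p) nA sA) (hB : strip.Joins (0, f) (0, g) nB sB)
    (hAB : ∀ j ≤ c, ∀ r, (j, r) ∈ sA ∪ sB) (hnAB : nA + nB = 4 * c + 2)
    (hone : OneStrand n p p')
    (hC : strip.Joins (c + 2 * n + 1, p') (d, q) nC sC) (hD : strip.Joins (d, q') v nD sD)
    (hCD : ∀ j, c + 2 * n < j → j ≤ d → ∀ r, (j, r) ∈ sC ∪ sD)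
    (hnCD : nC + nD + 2 + 4 * (c + 2 * n) = 4 * d)
    (htwo : TwoStrands m q q' (-f) (-g)) :
    ∃ w : (isaacsGraph k).Walk (cover hk u) (cover hk v), w.IsHamiltonian := by
  obtain ⟨n₁, n₂, s₁, s₂, h₁, h₂, hn, hs⟩ := htwo d
  have hf' : -f ≠ 0 := neg_ne_zero.2 hf
  have hg' : -g ≠ 0 := neg_ne_zero.2 hg
  have e₁ : strip.Joins (d + m, -f) (k, -f) 1 ∅ := hkd ▸ .adj (strip_adj_succ hf')
  have e₂ : strip.Joins (k, -g) (d + m, -g) 1 ∅ := hkd ▸ .adj (strip_adj_pred hg')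
  -- `P` runs from `u` forward to `(k, -f)`, which is `(0, f)` in `J_k`; then `hB` leads to `(0,
  -- g)`, that is `(k, -g)`, and `R` returns along the second strand to `v`.
  have P := (hA.trans <| (hone c).trans <| (Joins.adj (strip_adj_succ hp')).trans <|
    hC.trans <| h₁.trans e₁).map (cover hk)
  have R := (e₂.trans <| h₂.symm.trans hD).map (cover hk)
  rw [cover_wrap hk hodd] at P R
  refine exists_isHamiltonian_of_joins hk (P.trans ((hB.map (cover hk)).trans R)) (by omega) ?_
  intro j hj r
  simp only [← Set.image_union]
  refine Set.mem_image_of_mem _ ?_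
  by_cases h1 : j ≤ c
  · rcases hAB j h1 r with h | h <;> simp [h]
  by_cases h2 : j ≤ c + 2 * n
  · have : (j, r) ∈ columns c (2 * n) := ⟨by simpa using h1, h2⟩
    simp [this]
  by_cases h3 : j ≤ d
  · rcases hCD j (by omega) h3 r with h | h <;> simp [h]
  · have : (j, r) ∈ columns d m := ⟨by simpa using h3, by change j ≤ d + m; omega⟩
    rcases hs this with h | h <;> simp [h]


/-- Column 0 is `a` together with the turn `f, 0, g`; column `2n + 1` is `b` together with the
passage `p, 0, e`. For `n = 0` there is no room to change tracks, so `p = a` and `a ≠ b` is needed.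
-/
theorem exists_isHamiltonian_tracks [NeZero k] (hk : 1 < k) (hodd : Odd k) (hk7 : 7 ≤ k) {n m : ℕ}
    (hkn : k = 2 * n + 2 + m) {a b : Fin 4} (ha : a ≠ 0) (hb : b ≠ 0) (hab : n = 0 → a ≠ b) :
    ∃ w : (isaacsGraph k).Walk (cover hk (0, a)) (cover hk (2 * n + 1, b)), w.IsHamiltonian := by
  have hm : Odd m := by
    rw [Nat.odd_iff] at hodd
    rw [Nat.odd_iff]
    omega
  obtain ⟨e, p, f, g, he, hp, hf, hg, hfg, haf, hag, hep, hbe, hbp, h1, h2⟩ :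
      ∃ e p f g : Fin 4, e ≠ 0 ∧ p ≠ 0 ∧ f ≠ 0 ∧ g ≠ 0 ∧ f ≠ g ∧ a ≠ f ∧ a ≠ g ∧ e ≠ p ∧ b ≠ e ∧
        b ≠ p ∧ OneStrand n a p ∧ TwoStrands m e b (-f) (-g) := by
    rcases Nat.eq_zero_or_pos n with rfl | hn
    · have : ∀ a b : Fin 4, a ≠ 0 ∧ b ≠ 0 ∧ a ≠ b → ∃ e f g : Fin 4, e ≠ 0 ∧ f ≠ 0 ∧ g ≠ 0 ∧ f ≠ g ∧
          a ≠ f ∧ a ≠ g ∧ e ≠ a ∧ b ≠ e ∧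
          (-f ≠ e ∧ -g = b ∨ -f = e ∧ -g ≠ b ∨ -f = b ∧ -g = e) := by decide
      obtain ⟨e, f, g, he, hf, hg, hfg, haf, hag, hea, hbe, h⟩ := this a b ⟨ha, hb, hab rfl⟩
      exact ⟨e, a, f, g, he, ha, hf, hg, hfg, haf, hag, hea, hbe, (hab rfl).symm, .zero a,
        .of_odd hm (by omega) he hb (neg_ne_zero.2 hf) (neg_ne_zero.2 hg) hbe.symm
          (neg_injective.ne hfg) h⟩
    -- With `m = 1` two strands cannot exchange their tracks; but then `7 ≤ k` gives `2 ≤ n`, so `p`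
    -- is not restricted by `a`.
    · rcases (show m = 1 ∨ 3 ≤ m by obtain ⟨l, rfl⟩ := hm; omega) with rfl | hm3
      · have : ∀ a b : Fin 4, a ≠ 0 → b ≠ 0 → ∃ e p f g : Fin 4, e ≠ 0 ∧ p ≠ 0 ∧ f ≠ 0 ∧ g ≠ 0 ∧
            f ≠ g ∧ a ≠ f ∧ a ≠ g ∧ e ≠ p ∧ b ≠ e ∧ b ≠ p ∧
            (-f ≠ e ∧ -g = b ∨ -f = e ∧ -g ≠ b) := by decide
        obtain ⟨e, p, f, g, he, hp, hf, hg, hfg, haf, hag, hep, hbe, hbp, h⟩ := this a b ha hb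
        exact ⟨e, p, f, g, he, hp, hf, hg, hfg, haf, hag, hep, hbe, hbp,
          .of_two_le (by omega) ha hp,
          .one_or he hb (neg_ne_zero.2 hf) (neg_ne_zero.2 hg) hbe.symm (neg_injective.ne hfg) h⟩
      · have : ∀ a b : Fin 4, a ≠ 0 → b ≠ 0 → ∃ e p f g : Fin 4, e ≠ 0 ∧ p ≠ 0 ∧ f ≠ 0 ∧ g ≠ 0 ∧
            f ≠ g ∧ a ≠ f ∧ a ≠ g ∧ e ≠ p ∧ b ≠ e ∧ b ≠ p ∧ a ≠ p ∧
            (-f ≠ e ∧ -g = b ∨ -f = e ∧ -g ≠ b ∨ -f = b ∧ -g = e) := by decide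
        obtain ⟨e, p, f, g, he, hp, hf, hg, hfg, haf, hag, hep, hbe, hbp, hap, h⟩ := this a b ha hb
        exact ⟨e, p, f, g, he, hp, hf, hg, hfg, haf, hag, hep, hbe, hbp,
          .of_ne (by omega) ha hp hap, .of_odd hm hm3 he hb (neg_ne_zero.2 hf) (neg_ne_zero.2 hg)
            hbe.symm (neg_injective.ne hfg) h⟩
  refine exists_isHamiltonian_of_strands hk hodd (c := 0) (d := 2 * n + 1) (n := n) (m := m)
    (by omega) hp hf hg (.nil _)
    (.cons (strip_adj_zero hf) <| .cons (strip_zero_adj hg) <| .nil _) ?_ rfl h1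
    (.cons (by simpa using strip_adj_zero hp) <| .cons (strip_zero_adj he) <| .nil _) (.nil _)
    ?_ (by omega) h2
  · intro j hj r
    obtain rfl : j = 0 := by omega
    rcases eq_or_eq a f g ha hf hg haf hag hfg r with rfl | rfl | rfl | rfl <;> simp
  · intro j hj hj' r
    obtain rfl : j = 2 * n + 1 := by omega
    rcases eq_or_eq b e p hb he hp hbe hbp hep r with rfl | rfl | rfl | rfl <;> simp

/-- The start at a centre needs the two columns 0 and 1: the path leaves by `a`, and the turn `f …
g` uses the centre of column 1. -/
theorem exists_isHamiltonian_center_track [NeZero k] (hk : 1 < k) (hodd : Odd k) (hk7 : 7 ≤ k)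
    {n m : ℕ} (hkn : k = 2 * n + 3 + m) {b : Fin 4} (hb : b ≠ 0) :
    ∃ w : (isaacsGraph k).Walk (cover hk (0, 0)) (cover hk (2 * n + 2, b)), w.IsHamiltonian := by
  have hm : Even m := by
    rw [Nat.odd_iff] at hodd
    rw [Nat.even_iff]
    omega
  obtain ⟨a, e, p, f, g, ha, he, hp, hf, hg, hfg, haf, hag, hep, hbe, hbp, h1, h2⟩ :
      ∃ a e p f g : Fin 4, a ≠ 0 ∧ e ≠ 0 ∧ p ≠ 0 ∧ f ≠ 0 ∧ g ≠ 0 ∧ f ≠ g ∧ a ≠ f ∧ a ≠ g ∧ e ≠ p ∧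
        b ≠ e ∧ b ≠ p ∧ OneStrand n a p ∧ TwoStrands m e b (-f) (-g) := by
    -- For `m = 0` no column is left for the two strands, which forces `e = -f` and `b = -g`; here
    -- `7 ≤ k` gives `2 ≤ n`.
    rcases Nat.eq_zero_or_pos m with rfl | hm0
    · have : ∀ b : Fin 4, b ≠ 0 → ∃ a p f : Fin 4, a ≠ 0 ∧ p ≠ 0 ∧ f ≠ 0 ∧
          f ≠ -b ∧ a ≠ f ∧ a ≠ -b ∧ -f ≠ p ∧ b ≠ -f ∧ b ≠ p := by decide
      obtain ⟨a, p, f, ha, hp, hf, hfb, haf, hab, hfp, hbf, hbp⟩ := this b hb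
      refine ⟨a, -f, p, f, -b, ha, neg_ne_zero.2 hf, hp, hf, neg_ne_zero.2 hb, hfb, haf, hab, hfp,
        hbf, hbp, .of_two_le (by omega) ha hp, ?_⟩
      rw [neg_neg]
      exact .zero _ _
    · have hm2 : 2 ≤ m := by obtain ⟨l, rfl⟩ := hm; omega
      rcases Nat.eq_zero_or_pos n with rfl | hn
      · have : ∀ b : Fin 4, b ≠ 0 → ∃ a e f g : Fin 4, a ≠ 0 ∧ e ≠ 0 ∧ f ≠ 0 ∧ g ≠ 0 ∧
            f ≠ g ∧ a ≠ f ∧ a ≠ g ∧ e ≠ a ∧ b ≠ e ∧ b ≠ a ∧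
            (-f = e ∧ -g = b ∨ -f = b ∧ -g ≠ e ∧ -g ≠ b ∨ -g = e ∧ -f ≠ e ∧ -f ≠ b) := by decide
        obtain ⟨a, e, f, g, ha, he, hf, hg, hfg, haf, hag, hea, hbe, hba, h⟩ := this b hb
        exact ⟨a, e, a, f, g, ha, he, ha, hf, hg, hfg, haf, hag, hea, hbe, hba, .zero a,
          .of_even hm hm2 he hb (neg_ne_zero.2 hf) (neg_ne_zero.2 hg) hbe.symm h⟩
      · have : ∀ b : Fin 4, b ≠ 0 → ∃ a e p f g : Fin 4, a ≠ 0 ∧ e ≠ 0 ∧ p ≠ 0 ∧ f ≠ 0 ∧ g ≠ 0 ∧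
            f ≠ g ∧ a ≠ f ∧ a ≠ g ∧ e ≠ p ∧ b ≠ e ∧ b ≠ p ∧ a ≠ p ∧
            (-f = e ∧ -g = b ∨ -f = b ∧ -g ≠ e ∧ -g ≠ b ∨ -g = e ∧ -f ≠ e ∧ -f ≠ b) := by decide
        obtain ⟨a, e, p, f, g, ha, he, hp, hf, hg, hfg, haf, hag, hep, hbe, hbp, hap, h⟩ := this b hb
        exact ⟨a, e, p, f, g, ha, he, hp, hf, hg, hfg, haf, hag, hep, hbe, hbp,
          .of_ne hn ha hp hap,
          .of_even hm hm2 he hb (neg_ne_zero.2 hf) (neg_ne_zero.2 hg) hbe.symm h⟩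
  refine exists_isHamiltonian_of_strands hk hodd (c := 1) (d := 2 * n + 2) (n := n) (m := m)
    (by omega) hp hf hg
    (.cons (strip_zero_adj ha) <| .cons (strip_adj_succ ha) <| .nil _)
    (.cons (strip_adj_succ hf) <| .cons (strip_adj_zero hf) <| .cons (strip_zero_adj hg) <|
      .cons (strip_adj_pred hg) <| .nil _) ?_ rfl h1
    (.cons (v := (2 * n + 2, 0)) (by
      rw [show 1 + 2 * n + 1 = 2 * n + 2 by ring]; exact strip_adj_zero hp) <|
      .cons (strip_zero_adj he) <| .nil _) (.nil _)
    ?_ (by omega) h2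
  · intro j hj r
    obtain rfl | rfl : j = 0 ∨ j = 1 := by omega
    all_goals
      rcases eq_or_eq a f g ha hf hg haf hag hfg r with rfl | rfl | rfl | rfl <;> simp
  · intro j hj hj' r
    obtain rfl : j = 2 * n + 2 := by omega
    rcases eq_or_eq b e p hb he hp hbe hbp hep r with rfl | rfl | rfl | rfl <;> simp <;> omega

/-- Both ends take two columns: in the last two, the outgoing strand stays on `p`, and the returning
one goes back on `b`, through the earlier centre, and out on `e` to the final centre. -/
theorem exists_isHamiltonian_centers [NeZero k] (hk : 1 < k) (hodd : Odd k) (hk7 : 7 ≤ k)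
    {n m : ℕ} (hkn : k = 2 * n + 4 + m) :
    ∃ w : (isaacsGraph k).Walk (cover hk (0, 0)) (cover hk (2 * n + 3, 0)), w.IsHamiltonian := by
  have hm : Odd m := by
    rw [Nat.odd_iff] at hodd
    rw [Nat.odd_iff]
    omega
  obtain ⟨a, b, e, p, f, g, ha, hb, he, hp, hf, hg, hfg, haf, hag, hep, hbe, hbp, h1, h2⟩ :
      ∃ a b e p f g : Fin 4, a ≠ 0 ∧ b ≠ 0 ∧ e ≠ 0 ∧ p ≠ 0 ∧ f ≠ 0 ∧ g ≠ 0 ∧ f ≠ g ∧ a ≠ f ∧ a ≠ g ∧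
        e ≠ p ∧ b ≠ e ∧ b ≠ p ∧ OneStrand n a p ∧ TwoStrands m p b (-f) (-g) := by
    rcases Nat.eq_zero_or_pos n with rfl | hn
    · exact ⟨1, 3, 2, 1, 3, 2, by decide, by decide, by decide, by decide, by decide, by decide,
        by decide, by decide, by decide, by decide, by decide, by decide, .zero 1,
        .of_odd hm (by omega) (by decide) (by decide) (by decide) (by decide) (by decide)
          (by decide) (by decide)⟩
    · refine ⟨1, 1, 2, 3, 2, 3, by decide, by decide, by decide, by decide, by decide, by decide,
        by decide, by decide, by decide, by decide, by decide, by decide,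
        .of_ne hn (by decide) (by decide) (by decide), ?_⟩
      rcases (show m = 1 ∨ 3 ≤ m by obtain ⟨l, rfl⟩ := hm; omega) with rfl | hm3
      · exact .one_or (by decide) (by decide) (by decide) (by decide) (by decide) (by decide)
          (by decide)
      · exact .of_odd hm hm3 (by decide) (by decide) (by decide) (by decide) (by decide) (by decide)
          (by decide)
  refine exists_isHamiltonian_of_strands hk hodd (c := 1) (d := 2 * n + 3) (n := n) (m := m)
    (by omega) hp hf hg
    (.cons (strip_zero_adj ha) <| .cons (strip_adj_succ ha) <| .nil _)
    (.cons (strip_adj_succ hf) <| .cons (strip_adj_zero hf) <| .cons (strip_zero_adj hg) <|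
      .cons (strip_adj_pred hg) <| .nil _) ?_ rfl h1
    (.cons (v := (2 * n + 3, p)) (by
      rw [show 1 + 2 * n + 1 = 2 * n + 2 by ring]; exact strip_adj_succ hp) <| .nil _)
    (.cons (strip_adj_pred (c := 2 * n + 2) hb) <| .cons (strip_adj_zero hb) <|
      .cons (strip_zero_adj he) <| .cons (strip_adj_succ he) <| .cons (strip_adj_zero he) <| .nil _)
    ?_ (by omega) h2
  · intro j hj r
    obtain rfl | rfl : j = 0 ∨ j = 1 := by omega
    all_goals
      rcases eq_or_eq a f g ha hf hg haf hag hfg r with rfl | rfl | rfl | rfl <;> simp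
  · intro j hj hj' r
    obtain rfl | rfl : j = 2 * n + 2 ∨ j = 2 * n + 3 := by omega
    all_goals
      rcases eq_or_eq b e p hb he hp hbe hbp hep r with rfl | rfl | rfl | rfl <;> simp <;> omega

/-- The two-column ends do not fit here. Instead both strands are traversed forwards, the path going
around twice: on track 1 from column 0 back to `(0, 2)`, then on track 2 back to `(0, 3)`, and
finally to `(1, 3)` and `(1, 0)`. -/
theorem exists_isHamiltonian_adjacent_centers [NeZero k] (hk : 1 < k) (hodd : Odd k)
    (hk7 : 7 ≤ k) :
    ∃ w : (isaacsGraph k).Walk (cover hk (0, 0)) (cover hk (1, 0)), w.IsHamiltonian := by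
  obtain ⟨m, hkm⟩ := Nat.exists_eq_add_of_le (show 2 ≤ k by omega)
  have hm : Odd m := by
    rw [Nat.odd_iff] at hodd
    rw [Nat.odd_iff]
    omega
  obtain ⟨n₁, n₂, s₁, s₂, h₁, h₂, hn, hs⟩ := TwoStrands.of_odd hm (by omega) (a := 1) (b := 2)
    (a' := -2) (b' := -3) (by decide) (by decide) (by decide) (by decide) (by decide) (by decide)
    (by decide) 1
  have e : ∀ r : Fin 4, r ≠ 0 → strip.Joins (1 + m, r) (k, r) 1 ∅ := fun r hr =>
    .adj (by rw [show k = 1 + m + 1 by omega]; exact strip_adj_succ hr)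
  have P := (Joins.cons (strip_zero_adj (by decide)) <|
    .cons (strip_adj_succ (c := 0) (r := 1) (by decide)) <| (Joins.nil _).trans <| h₁.trans (e _ (by decide))).map
    (cover hk)
  have Q := (Joins.cons (strip_adj_succ (c := 0) (r := 2) (by decide)) <|
    (Joins.nil _).trans <| h₂.trans (e _ (by decide))).map (cover hk)
  have R := (Joins.cons (strip_adj_succ (c := 0) (r := 3) (by decide)) <|
    .cons (strip_adj_zero (by decide)) <| .nil _).map (cover hk)
  rw [cover_wrap hk hodd] at P Q
  refine exists_isHamiltonian_of_joins hk (P.trans (Q.trans R)) (by omega) ?_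
  intro j hj r
  simp only [← Set.image_union]
  refine Set.mem_image_of_mem _ ?_
  by_cases h1 : 1 < j
  · have : (j, r) ∈ columns 1 m := ⟨h1, by change j ≤ 1 + m; omega⟩
    rcases hs this with h | h <;> simp [h]
  · obtain rfl | rfl : j = 0 ∨ j = 1 := by omega
    all_goals fin_cases r <;> simp

end isaacsGraph

/-! ### Transport by automorphisms, and paths obtained from closed walks. -/

section

variable {V : Type*} {G : SimpleGraph V}

theorem SimpleGraph.Walk.IsHamiltonian.reverse [DecidableEq V] {u v : V} {p : G.Walk u v}
    (hp : p.IsHamiltonian) : p.reverse.IsHamiltonian := by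
  intro a
  rw [Walk.support_reverse, List.count_reverse]
  exact hp a

theorem SimpleGraph.Iso.exists_isHamiltonian [DecidableEq V] (φ : G ≃g G) {u v : V}
    (h : ∃ p : G.Walk (φ u) (φ v), p.IsHamiltonian) : ∃ p : G.Walk u v, p.IsHamiltonian := by
  obtain ⟨p, hp⟩ := h
  refine ⟨(p.map φ.symm.toHom).copy (φ.symm_apply_apply u) (φ.symm_apply_apply v), ?_⟩
  have := hp.map φ.symm.toHom φ.symm.bijective
  intro a
  rw [Walk.support_copy]
  exact this a

/-- A closed walk visiting each vertex but `y` exactly once gives, for every `x ≠ y`, a path from `x`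
to a neighbour of `x` with the same vertices. -/
theorem SimpleGraph.Joins.exists_isPath [Fintype V] [DecidableEq V] {b x y : V} {n : ℕ} {s : Set V}
    (h : G.Joins b b n s) (hn : n + 1 = Fintype.card V) (hs : ∀ v, v ≠ y → v ∈ s) (hxy : x ≠ y) :
    ∃ (w : V) (p : G.Walk x w), p.IsPath ∧ G.Adj x w ∧ ∀ v, v ∈ p.support ↔ v ≠ y := by
  obtain ⟨c, rfl, hc⟩ := h
  have hx : x ∈ c.support := hc x (hs x hxy)
  have hlen := c.length_rotate x hx
  have hsupp : ∀ v, v ≠ y → v ∈ (c.rotate x hx).support := fun v hv =>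
    (c.mem_support_rotate_iff x hx).2 (hc v (hs v hv))
  have hcard : 1 < Fintype.card V := Fintype.one_lt_card_iff.2 ⟨x, y, hxy⟩
  generalize c.rotate x hx = c' at hlen hsupp
  cases c' with
  | nil => simp at hlen; omega
  | @cons _ z _ hadj q =>
    have hsub : Finset.univ.erase y ⊆ q.support.toFinset := by
      intro v hv
      rw [List.mem_toFinset]
      have := hsupp v (Finset.ne_of_mem_erase hv)
      rw [Walk.support_cons, List.mem_cons] at this
      rcases this with rfl | h
      · exact q.end_mem_support
      · exact h
    have hcard' : (Finset.univ.erase y).card = q.support.length := by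
      rw [Finset.card_erase_of_mem (Finset.mem_univ _), Finset.card_univ, Walk.length_support]
      rw [Walk.length_cons] at hlen
      omega
    have heq : Finset.univ.erase y = q.support.toFinset :=
      Finset.eq_of_subset_of_card_le hsub (by rw [hcard']; exact List.toFinset_card_le _)
    refine ⟨z, q.reverse, ?_, hadj, fun v => ?_⟩
    · rw [Walk.isPath_reverse_iff, Walk.isPath_def, ← Multiset.coe_nodup,
        ← Multiset.toFinset_card_eq_card_iff_nodup]
      change q.support.toFinset.card = q.support.length
      rw [← heq, hcard']
    · rw [Walk.support_reverse, List.mem_reverse, ← List.mem_toFinset, ← heq]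
      simp

theorem SimpleGraph.Joins.of_iso (φ : G ≃g G) {b : V} {n : ℕ} {s : Set V} (h : G.Joins b b n s) :
    G.Joins (φ b) (φ b) n (φ '' s) := h.map φ.toHom

end

/-! ### Symmetries of `J_k`, almost Hamiltonian cycles, and arbitrary nonadjacent pairs. -/

namespace isaacsGraph

variable {k : ℕ}

/-- The rotation by `t` columns. -/
def rotation (hk : 1 < k) (t : ZMod k) : isaacsGraph k ≃g isaacsGraph k where
  toEquiv := (Equiv.addRight t).prodCongr (Equiv.refl _)
  map_rel_iff' := by
    intro a b
    simp [adj_iff hk, add_right_comm _ t 1]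

/-- The reflection that reverses the order of the columns. -/
def reflection (hk : 1 < k) : isaacsGraph k ≃g isaacsGraph k where
  toEquiv := (Equiv.neg (ZMod k)).prodCongr (Equiv.refl _)
  map_rel_iff' := by
    intro a b
    have h1 : ∀ i j : ZMod k, -i = -j + 1 ↔ j = i + 1 := fun i j => by
      constructor <;> intro h <;> linear_combination h
    simp [adj_iff hk, h1, or_comm]

/-- One strand starting at `a` sweeps all other columns and returns to the third track `w` of column
0; the centre and `b` complete the path. -/
theorem exists_isHamiltonian_same_column [NeZero k] (hk : 1 < k) (hodd : Odd k)
    (hk7 : 7 ≤ k) {a b : Fin 4} (ha : a ≠ 0) (hb : b ≠ 0) (hab : a ≠ b) :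
    ∃ w : (isaacsGraph k).Walk (cover hk (0, a)) (cover hk (0, b)), w.IsHamiltonian := by
  obtain ⟨n, hn⟩ := hodd
  obtain ⟨w, hw, hwa, hwb⟩ := exists_third a b
  have hw' : -w ≠ 0 := neg_ne_zero.2 hw
  have e : strip.Joins (0 + 2 * n, -w) (k, -w) 1 ∅ :=
    .adj (by rw [show k = 0 + 2 * n + 1 by omega]; exact strip_adj_succ hw')
  have P := ((Joins.nil _).trans <|
    (OneStrand.of_two_le (show 2 ≤ n by omega) ha hw' 0).trans e).map (cover hk)
  have Q := (Joins.cons (strip_adj_zero (c := 0) hw) <| .cons (strip_zero_adj hb) <| .nil _).map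
    (cover hk)
  rw [cover_wrap hk ⟨n, hn⟩] at P
  refine exists_isHamiltonian_of_joins hk (P.trans Q) (by omega) ?_
  intro j hj r
  simp only [← Set.image_union]
  refine Set.mem_image_of_mem _ ?_
  rcases Nat.eq_zero_or_pos j with rfl | hj0
  · rcases eq_or_eq a b w ha hb hw hab hwa.symm hwb.symm r with rfl | rfl | rfl | rfl <;> simp
  · have : (j, r) ∈ columns 0 (2 * n) := ⟨hj0, by change j ≤ 0 + 2 * n; omega⟩
    simp [this]

/-- `J_k` has a cycle missing only a given vertex. -/
theorem exists_isPath_avoiding [NeZero k] (hk : 1 < k) (hodd : Odd k) (hk7 : 7 ≤ k)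
    {x y : ZMod k × Fin 4} (hxy : x ≠ y) :
    ∃ (w : ZMod k × Fin 4) (p : (isaacsGraph k).Walk x w), p.IsPath ∧ (isaacsGraph k).Adj x w ∧
      ∀ v, v ∈ p.support ↔ v ≠ y := by
  obtain ⟨b, l, s, hJ, hl, hs⟩ : ∃ b l s, (isaacsGraph k).Joins b b l s ∧ l + 1 = 4 * k ∧
      ∀ j < k, ∀ r, (j, r) ≠ (0, y.2) → cover hk (j, r) ∈ s := by
    obtain ⟨n, hn⟩ := hodd
    by_cases hy : y.2 = 0
    -- Missing centre: one strand sweeps all columns but 0 and its two neighbours. The columns on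
    -- either side of column 0 are also used for detours through their centres, which connect the
    -- tracks of column 0.
    · obtain ⟨n, rfl⟩ : ∃ l, n = l + 1 := ⟨n - 1, by omega⟩
      have e : ∀ r : Fin 4, r ≠ 0 → strip.Adj (2 * n + 2, r) (k, r) := fun r hr => by
        rw [show k = 2 * n + 2 + 1 by omega]; exact strip_adj_succ hr
      have hone := OneStrand.of_two_le (n := n) (r := 1) (s := 2) (by omega) (by decide)
        (by decide) 1
      have P := (Joins.cons (strip_adj_succ (c := 0) (r := 1) (by decide)) <| (Joins.nil _).trans <|
        hone.trans <| .cons (v := (2 * n + 2, 2)) (by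
          rw [show 1 + 2 * n = 2 * n + 1 by ring]; exact strip_adj_succ (by decide)) <|
        .cons (e (-2) (by decide)) <| .nil _).map (cover hk)
      have Q := (Joins.cons (strip_adj_succ (c := 0) (r := 2) (by decide)) <|
        .cons (strip_adj_zero (by decide)) <| .cons (strip_zero_adj (r := 3) (by decide)) <|
        .cons (strip_adj_pred (by decide)) <| .nil _).map (cover hk)
      have R := (Joins.cons (e (-3) (by decide)).symm <| .cons (strip_adj_zero (by decide)) <|
        .cons (strip_zero_adj (r := 3) (by decide)) <|
        .cons (e (-1) (by decide)) <| .nil _).map (cover hk)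
      rw [cover_wrap hk ⟨_, hn⟩] at P R
      rw [cover_wrap hk ⟨_, hn⟩] at R
      refine ⟨_, _, _, P.trans (Q.trans R), by omega, fun j hj r hjr => ?_⟩
      simp only [← Set.image_union]
      refine Set.mem_image_of_mem _ ?_
      by_cases h1 : 1 < j ∧ j ≤ 1 + 2 * n
      · have : (j, r) ∈ columns 1 (2 * n) := h1
        simp [this]
      · obtain rfl | rfl | rfl : j = 0 ∨ j = 1 ∨ j = 2 * n + 2 := by omega
        · rw [hy] at hjr
          fin_cases r <;> first | exact (hjr rfl).elim | simp
        · fin_cases r <;> simp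
        · have h13 : (-3 : Fin 4) = 1 := by decide
          fin_cases r <;> simp [h13]
    -- Missing track vertex: one strand around from `f` to `e`, closed through the centre of column
    -- 0.
    · obtain ⟨e, he, hey, -⟩ := exists_third y.2 y.2
      obtain ⟨f, hf, hfy, hfe⟩ := exists_third y.2 e
      have he' : -e ≠ 0 := neg_ne_zero.2 he
      have hstep : strip.Joins (0 + 2 * n, -e) (k, -e) 1 ∅ :=
        .adj (by rw [show k = 0 + 2 * n + 1 by omega]; exact strip_adj_succ he')
      have P := ((OneStrand.of_two_le (show 2 ≤ n by omega) hf he' 0).trans hstep).map (cover hk)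
      have Q := (Joins.cons (strip_adj_zero (c := 0) he) <| .cons (strip_zero_adj hf) <|
        .nil _).map (cover hk)
      rw [cover_wrap hk ⟨n, hn⟩] at P
      refine ⟨_, _, _, P.trans Q, by omega, fun j hj r hjr => ?_⟩
      simp only [← Set.image_union]
      refine Set.mem_image_of_mem _ ?_
      rcases Nat.eq_zero_or_pos j with rfl | hj0
      · rcases eq_or_eq y.2 e f hy he hf hey.symm hfy.symm hfe.symm r with rfl | rfl | rfl | rfl
        · simp
        · exact (hjr rfl).elim
        · simp
        · simp
      · have : (j, r) ∈ columns 0 (2 * n) := ⟨hj0, by change j ≤ 0 + 2 * n; omega⟩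
        simp [this]
  have h := hJ.of_iso (rotation hk y.1)
  have hcard : Fintype.card (ZMod k × Fin 4) = 4 * k := by simp [ZMod.card, mul_comm]
  refine h.exists_isPath (by omega) (fun v hv => ?_) hxy
  obtain ⟨j, hj, r, hjr⟩ := exists_cover hk (v.1 - y.1, v.2)
  refine ⟨(v.1 - y.1, v.2), hjr ▸ hs j hj r fun h => hv ?_, Prod.ext (sub_add_cancel _ _) rfl⟩
  obtain ⟨rfl, rfl⟩ := Prod.mk.inj h
  rw [cover_apply] at hjr
  have h1 := congrArg Prod.fst hjr
  have h2 := congrArg Prod.snd hjr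
  simp [twist] at h1 h2
  exact Prod.ext (sub_eq_zero.1 h1.symm) h2.symm

/-- The constructions require odd distance between two centres or two track vertices, and even
distance from a centre to a track vertex, because a single strand sweeps an even number of columns.
-/
theorem exists_isHamiltonian_of_parity [NeZero k] (hk : 1 < k) (hodd : Odd k) (hk7 : 7 ≤ k)
    {a s : Fin 4} {d : ℕ} (hd : d < k) (hd0 : 0 < d) (has : s = 0 → a = 0)
    (hpar : a = 0 ∧ s ≠ 0 ↔ Even d) (hadj : ¬ (isaacsGraph k).Adj (0, a) (d, s)) :
    ∃ p : (isaacsGraph k).Walk (0, a) (d, s), p.IsHamiltonian := by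
  have hu : cover hk (0, a) = (0, a) := by simp [cover_apply, twist]
  have hv : cover hk (d, twist d s) = ((d : ZMod k), s) := by simp [cover_apply, twist_twist]
  rw [← hu, ← hv]
  by_cases hs : s = 0
  · obtain rfl := has hs
    subst hs
    have : Odd d := by rw [← Nat.not_even_iff_odd, ← hpar]; simp
    rw [show twist d 0 = 0 by simp [twist_eq_zero]]
    obtain ⟨n, rfl⟩ := this
    rcases Nat.eq_zero_or_pos n with rfl | hn
    · exact exists_isHamiltonian_adjacent_centers hk hodd hk7
    · obtain ⟨n, rfl⟩ : ∃ l, n = l + 1 := ⟨n - 1, by omega⟩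
      obtain ⟨c, hc⟩ := hodd
      exact exists_isHamiltonian_centers hk ⟨c, hc⟩ hk7 (n := n) (m := k - (2 * n + 4)) (by omega)
  · have hs' : twist d s ≠ 0 := by rwa [Ne, twist_eq_zero]
    by_cases ha : a = 0
    · subst ha
      obtain ⟨n, rfl⟩ : ∃ n, d = 2 * n + 2 := by
        obtain ⟨c, hc⟩ := hpar.1 ⟨rfl, hs⟩
        exact ⟨c - 1, by omega⟩
      exact exists_isHamiltonian_center_track hk hodd hk7 (m := k - (2 * n + 3)) (by omega) hs'
    · have : Odd d := by rw [← Nat.not_even_iff_odd, ← hpar]; simp [ha]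
      obtain ⟨n, rfl⟩ := this
      refine exists_isHamiltonian_tracks hk hodd hk7 (n := n) (m := k - (2 * n + 2))
        (by obtain ⟨c, hc⟩ := hodd; omega) ha hs' ?_
      rintro rfl rfl
      refine hadj ((adj_iff hk).2 (Or.inr ⟨ha, ?_, Or.inl (by simp)⟩))
      simp [twist]

theorem exists_isHamiltonian_of_imp [NeZero k] (hk : 1 < k) (hodd : Odd k) (hk7 : 7 ≤ k)
    {u v : ZMod k × Fin 4} (huv : u ≠ v) (hadj : ¬ (isaacsGraph k).Adj u v)
    (h0 : v.2 = 0 → u.2 = 0) : ∃ p : (isaacsGraph k).Walk u v, p.IsHamiltonian := by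
  obtain ⟨i, a⟩ := u
  obtain ⟨j, s⟩ := v
  refine (rotation hk (-i)).exists_isHamiltonian ?_
  rw [← (rotation hk (-i)).map_adj_iff] at hadj
  have hne := (rotation hk (-i)).injective.ne huv
  have h1 : rotation hk (-i) (i, a) = (0, a) := Prod.ext (add_neg_cancel i) rfl
  obtain ⟨t, ht⟩ : ∃ t, rotation hk (-i) (j, s) = (t, s) := ⟨_, rfl⟩
  rw [h1, ht] at hadj hne ⊢
  simp only at h0
  obtain ⟨d, hd, rfl⟩ : ∃ d < k, (d : ZMod k) = t := ⟨t.val, t.val_lt, ZMod.natCast_zmod_val t⟩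
  rcases Nat.eq_zero_or_pos d with rfl | hd0
  · have has : a ≠ s := by rintro rfl; simp at hne
    have ha : a ≠ 0 := by
      rintro rfl
      exact hadj ((adj_iff hk).2 (Or.inl ⟨by simp, by simpa using has.symm⟩))
    have := exists_isHamiltonian_same_column hk hodd hk7 ha (fun h => ha (h0 h)) has
    have hcover : ∀ r, cover hk (0, r) = (0, r) := fun r => by simp [cover_apply, twist]
    rw [hcover, hcover] at this
    rwa [Nat.cast_zero]
  · by_cases hpar : a = 0 ∧ s ≠ 0 ↔ Even d
    · exact exists_isHamiltonian_of_parity hk hodd hk7 hd hd0 h0 hpar hadj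
    -- The reflection replaces `d` by `k - d`, which has the other parity because `k` is odd.
    · refine (reflection hk).exists_isHamiltonian ?_
      rw [← (reflection hk).map_adj_iff] at hadj
      have h2 : reflection hk (0, a) = (0, a) := Prod.ext neg_zero rfl
      have h3 : reflection hk ((d : ZMod k), s) = (((k - d : ℕ) : ZMod k), s) := by
        refine Prod.ext ?_ rfl
        rw [Nat.cast_sub hd.le, ZMod.natCast_self, zero_sub]; rfl
      rw [h2, h3] at hadj ⊢
      refine exists_isHamiltonian_of_parity hk hodd hk7 (by omega) (by omega) h0 ?_ hadj
      rw [Nat.even_sub hd.le, iff_false_left (Nat.not_even_iff_odd.2 hodd)]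
      tauto

/-- Any two nonadjacent vertices of `J_k` are joined by a Hamiltonian path. -/
theorem exists_isHamiltonian [NeZero k] (hk : 1 < k) (hodd : Odd k) (hk7 : 7 ≤ k)
    {u v : ZMod k × Fin 4} (huv : u ≠ v) (hadj : ¬ (isaacsGraph k).Adj u v) :
    ∃ p : (isaacsGraph k).Walk u v, p.IsHamiltonian := by
  by_cases h0 : v.2 = 0 → u.2 = 0
  · exact exists_isHamiltonian_of_imp hk hodd hk7 huv hadj h0
  · obtain ⟨p, hp⟩ := exists_isHamiltonian_of_imp hk hodd hk7 huv.symm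
      (fun h => hadj h.symm) (by tauto)
    exact ⟨p.reverse, hp.reverse⟩

end isaacsGraph

/-! ### Nonhamiltonicity of `J_k` by 3-edge-colourings. -/

section

variable {V : Type*} {G : SimpleGraph V}

/-- A cubic graph of even order that has a Hamiltonian cycle has a proper 3-edge-colouring. -/
theorem SimpleGraph.exists_edge_coloring_of_isHamiltonian [Fintype V] [DecidableEq V]
    (hdeg : ∀ u, (G.neighborSet u).ncard ≤ 3) (heven : Even (Fintype.card V))
    (hcard : 2 < Fintype.card V) {x y : V} {p : G.Walk x y} (hp : p.IsHamiltonian)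
    (hxy : G.Adj y x) :
    ∃ c : V → V → Fin 3, (∀ u v, c u v = c v u) ∧
      ∀ u v w, G.Adj u v → G.Adj u w → v ≠ w → c u v ≠ c u w := by
  set N := Fintype.card V with hN
  have hlen : p.length + 1 = N := by rw [hN, ← hp.length_support, Walk.length_support]
  have hinj := hp.isPath.getVert_injOn
  obtain ⟨i, hi, hiv⟩ : ∃ i : V → ℕ, (∀ v, i v < N) ∧ ∀ v, p.getVert (i v) = v := by
    have : ∀ v, ∃ i < N, p.getVert i = v := fun v => by
      obtain ⟨n, hn, hle⟩ := Walk.mem_support_iff_exists_getVert.1 (hp.mem_support v)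
      exact ⟨n, by omega, hn⟩
    choose i hi hiv using this
    exact ⟨i, hi, hiv⟩
  have hvi : ∀ n < N, i (p.getVert n) = n := fun n hn => by
    have h1 := hi (p.getVert n)
    exact hinj (show _ ≤ p.length by omega) (show n ≤ p.length by omega) (hiv _)
  let nxt : V → V := fun v => if i v + 1 = N then x else p.getVert (i v + 1)
  have hinxt : ∀ v, i (nxt v) = if i v + 1 = N then 0 else i v + 1 := by
    intro v
    have h1 := hi v
    by_cases h : i v + 1 = N
    · simp only [nxt, h, if_true]
      conv_lhs => rw [← p.getVert_zero]
      exact hvi 0 (by omega)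
    · simp only [nxt, h, if_false]
      exact hvi _ (by omega)
  have hi_inj : ∀ u v, i u = i v → u = v := fun u v h => by rw [← hiv u, h, hiv]
  have hnxt_inj : ∀ u v, nxt u = nxt v → u = v := by
    intro u v h
    have h' := congrArg i h
    rw [hinxt, hinxt] at h'
    apply hi_inj
    split_ifs at h' <;> omega
  have hnxt_nxt : ∀ u, nxt (nxt u) ≠ u := by
    intro u h
    have h' := congrArg i h
    have h1 := hi u
    rw [hinxt, hinxt] at h'
    split_ifs at h' <;> omega
  have hnxt_adj : ∀ u, G.Adj u (nxt u) := by
    intro u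
    have h1 := hi u
    by_cases h : i u + 1 = N
    · simp only [nxt, h, if_true]
      have : u = y := by
        rw [← hiv u, show i u = p.length by omega, p.getVert_length]
      rwa [this]
    · simp only [nxt, h, if_false]
      have := p.adj_getVert_succ (i := i u) (by omega)
      rwa [hiv] at this
  have hnxt_surj : ∀ u, ∃ v, nxt v = u :=
    Finite.surjective_of_injective (fun u v => hnxt_inj u v)
  let par : V → Fin 3 := fun v => if Even (i v) then 0 else 1
  have hpar : ∀ v, par (nxt v) ≠ par v := by
    intro v
    simp only [par, hinxt]
    by_cases h : i v + 1 = N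
    · have : ¬ Even (i v) := by rw [← h, Nat.even_add_one] at heven; exact heven
      simp [h, this]
    · simp only [h, if_false, Nat.even_add_one]
      split_ifs <;> simp_all
  have hpar2 : ∀ v, par v ≠ 2 := fun v => by simp only [par]; split_ifs <;> decide
  -- Cycle edges alternate between 0 and 1, consistently at the wrap because the order is even; all
  -- other edges get 2.
  refine ⟨fun u v => if v = nxt u then par u else if u = nxt v then par v else 2, ?_, ?_⟩
  · intro u v
    by_cases h1 : v = nxt u
    · have h2 : u ≠ nxt v := fun h => hnxt_nxt u (by rw [← h1, ← h])
      simp [h1, (hnxt_nxt u).symm]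
    · simp [h1]
  · intro u v w hv hw hvw
    dsimp only
    by_cases hv1 : v = nxt u
    · have hw1 : w ≠ nxt u := fun h => hvw (hv1.trans h.symm)
      rw [if_pos hv1, if_neg hw1]
      split_ifs with h
      · rw [h]; exact hpar w
      · exact hpar2 u
    · rw [if_neg hv1]
      by_cases hv2 : u = nxt v
      · rw [if_pos hv2]
        have hw2 : u ≠ nxt w := fun h => hvw (hnxt_inj _ _ (hv2.symm.trans h))
        rw [if_neg hw2]
        split_ifs with h
        · rw [hv2]; exact (hpar v).symm
        · exact hpar2 v
      · rw [if_neg hv2]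
        by_cases hw1 : w = nxt u
        · rw [if_pos hw1]; exact (hpar2 u).symm
        · rw [if_neg hw1]
          by_cases hw2 : u = nxt w
          · rw [if_pos hw2]; exact (hpar2 w).symm
          -- Two edges off the cycle at `u` would, with its two cycle edges, give four neighbours.
          · exfalso
            obtain ⟨z, hz⟩ := hnxt_surj u
            have hsub : (({v, w, nxt u, z} : Finset V) : Set V) ⊆ G.neighborSet u := by
              intro t ht
              simp only [Finset.coe_insert, Finset.coe_singleton, Set.mem_insert_iff,
                Set.mem_singleton_iff] at ht
              rcases ht with rfl | rfl | rfl | rfl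
              · exact hv
              · exact hw
              · exact hnxt_adj u
              · rw [mem_neighborSet, ← hz]; exact (hnxt_adj t).symm
            have hc : ({v, w, nxt u, z} : Finset V).card = 4 := by
              have hvz : v ≠ z := fun h => hv2 (by rw [h, hz])
              have hwz : w ≠ z := fun h => hw2 (by rw [h, hz])
              have hnz : nxt u ≠ z := fun h => hnxt_nxt u (by rw [h, hz])
              rw [Finset.card_insert_of_notMem, Finset.card_insert_of_notMem,
                Finset.card_pair hnz] <;> simp [hvw, hv1, hvz, hw1, hwz]
            have := Set.ncard_le_ncard hsub (Set.toFinite _)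
            rw [Set.ncard_coe_finset, hc] at this
            have := hdeg u
            omega

end

namespace isaacsGraph

variable {k : ℕ}

/-- An invariant of the colours of the three edges between two columns. -/
def orientation (a b c : Fin 3) : Bool :=
  if a = b then a = c + 1 else if b = c then b = a + 1 else if a = c then a = b + 1 else b = a + 1

/-- Here `a, b, c` colour the edges entering a column and `r, s, t` its spokes; the leaving edges
get the third colours, in reversed order since the twist exchanges tracks 1 and 3. -/
theorem orientation_step : ∀ a b c r s t : Fin 3,
    (r ≠ s ∧ r ≠ t ∧ s ≠ t ∧ a ≠ r ∧ b ≠ s ∧ c ≠ t) →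
    orientation (-(c + t)) (-(b + s)) (-(a + r)) = !orientation a b c := by
  decide

/-- The three colours add up to 0 modulo 3. -/
theorem eq_neg_add : ∀ a r o : Fin 3, (a ≠ r ∧ a ≠ o ∧ r ≠ o) → o = -(a + r) := by decide

/-- The invariant `F` flips from each column to the next, so after an odd number of columns it would
differ from itself. -/
theorem not_exists_edge_coloring (hk : 2 < k) (hodd : Odd k) :
    ¬ ∃ c : ZMod k × Fin 4 → ZMod k × Fin 4 → Fin 3, (∀ u v, c u v = c v u) ∧
      ∀ u v w, (isaacsGraph k).Adj u v → (isaacsGraph k).Adj u w → v ≠ w → c u v ≠ c u w := by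
  have : Fact (1 < k) := ⟨by omega⟩
  rintro ⟨c, hsymm, hc⟩
  have h2 : ∀ j : ZMod k, j - 1 ≠ j + 1 := by
    intro j h
    have : ((2 : ℕ) : ZMod k) = 0 := by push_cast; linear_combination -h
    rw [ZMod.natCast_eq_zero_iff] at this
    exact absurd (Nat.le_of_dvd two_pos this) (by omega)
  have hup : ∀ (j : ZMod k) (r : Fin 4), r ≠ 0 → (isaacsGraph k).Adj (j, r) (j + 1, -r) :=
    fun j r hr => (adj_iff (by omega)).2 (Or.inr ⟨hr, rfl, Or.inl rfl⟩)
  have hdown : ∀ (j : ZMod k) (r : Fin 4), r ≠ 0 → (isaacsGraph k).Adj (j, r) (j - 1, -r) :=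
    fun j r hr => (adj_iff (by omega)).2 (Or.inr ⟨hr, rfl, Or.inr (by simp)⟩)
  have hspoke : ∀ (j : ZMod k) (r : Fin 4), r ≠ 0 → (isaacsGraph k).Adj (j, r) (j, 0) :=
    fun j r hr => (adj_iff (by omega)).2 (Or.inl ⟨rfl, by simp [hr]⟩)
  let I : ZMod k → Fin 4 → Fin 3 := fun j r => c (j, r) (j - 1, -r)
  let S : ZMod k → Fin 4 → Fin 3 := fun j r => c (j, r) (j, 0)
  have hIS : ∀ j r, r ≠ 0 → I j r ≠ S j r := fun j r hr =>
    hc _ _ _ (hdown j r hr) (hspoke j r hr) (by simp)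
  have hSS : ∀ j r s, r ≠ 0 → s ≠ 0 → r ≠ s → S j r ≠ S j s := fun j r s hr hs hrs => by
    simp only [S]
    rw [hsymm _ (j, 0), hsymm _ (j, 0)]
    exact hc _ _ _ (hspoke j r hr).symm (hspoke j s hs).symm (by simp [hrs])
  have hI : ∀ j r, r ≠ 0 → I (j + 1) (-r) = -(I j r + S j r) := by
    intro j r hr
    have h1 : I (j + 1) (-r) = c (j, r) (j + 1, -r) := by
      simp only [I, add_sub_cancel_right, neg_neg]
      exact hsymm _ _
    rw [h1]
    refine eq_neg_add _ _ _ ⟨hIS j r hr, hc _ _ _ (hdown j r hr) (hup j r hr) ?_,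
      hc _ _ _ (hspoke j r hr) (hup j r hr) ?_⟩
    · simp [h2 j]
    · simp
  let F : ZMod k → Bool := fun j => orientation (I j 1) (I j 2) (I j 3)
  have hF : ∀ j, F (j + 1) = !F j := by
    intro j
    have e := orientation_step (I j 1) (I j 2) (I j 3) (S j 1) (S j 2) (S j 3)
      ⟨hSS j 1 2 (by decide) (by decide) (by decide), hSS j 1 3 (by decide) (by decide) (by decide),
        hSS j 2 3 (by decide) (by decide) (by decide), hIS j 1 (by decide), hIS j 2 (by decide),
        hIS j 3 (by decide)⟩
    rw [← hI j 1 (by decide), ← hI j 2 (by decide), ← hI j 3 (by decide)] at e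
    exact e
  have hFn : ∀ n : ℕ, F n = (if Even n then F 0 else !F 0) := by
    intro n
    induction n with
    | zero => simp
    | succ n ih =>
      rw [Nat.cast_succ, hF, ih]
      simp only [Nat.even_add_one]
      split_ifs <;> simp_all
  have := hFn k
  rw [ZMod.natCast_self, if_neg (Nat.not_even_iff_odd.2 hodd)] at this
  simp at this

/-- `J_k` is not Hamiltonian. -/
theorem not_isHamiltonian_of_adj [NeZero k] (hk : 2 < k) (hodd : Odd k) {x y : ZMod k × Fin 4}
    (p : (isaacsGraph k).Walk x y) (hp : p.IsHamiltonian) : ¬ (isaacsGraph k).Adj x y := by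
  intro hadj
  have hcard : Fintype.card (ZMod k × Fin 4) = k * 4 := by simp [ZMod.card]
  exact not_exists_edge_coloring hk hodd
    (exists_edge_coloring_of_isHamiltonian (fun u => (neighborSet_ncard hk u).le)
      (by rw [hcard]; exact (by decide : Even 4).mul_left k) (by omega) hp hadj.symm)

theorem detourSaturated_splitVertex (hodd : Odd k) (hk7 : 7 ≤ k) (x : ZMod k × Fin 4) :
    DetourSaturated (splitVertex (isaacsGraph k) x) := by
  have : NeZero k := ⟨by omega⟩
  refine splitVertex.detourSaturated (neighborSet_ncard (by omega) x)
    (fun y p hp => not_isHamiltonian_of_adj (by omega) hodd p hp)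
    (fun u v huv hadj => exists_isHamiltonian (by omega) hodd hk7 huv hadj)
    (fun y hy => exists_isPath_avoiding (by omega) hodd hk7 hy.ne)
    (fun y _ => exists_adj_ne (by omega))

end isaacsGraph

/-! ### The Coxeter graph: degree and girth. -/

namespace coxeterGraph

instance : DecidableRel coxeterGraph.Adj := fun a b =>
  decidable_of_iff _ (fromRel_adj _ a b).symm

/-- The neighbours of a vertex of the Coxeter graph. -/
def neighbors (v : ZMod 7 × Fin 4) : List (ZMod 7 × Fin 4) :=
  if v.2 = 0 then [(v.1, 1), (v.1, 2), (v.1, 3)]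
  else [(v.1, 0), (v.1 + (v.2.val : ZMod 7), v.2), (v.1 - (v.2.val : ZMod 7), v.2)]

theorem adj_iff_mem_neighbors : ∀ {a b : ZMod 7 × Fin 4}, coxeterGraph.Adj a b ↔ b ∈ neighbors a := by
  decide +kernel

theorem nodup_neighbors : ∀ v, (neighbors v).Nodup ∧ (neighbors v).length = 3 := by
  decide +kernel

theorem neighborSet_ncard (x : ZMod 7 × Fin 4) : (coxeterGraph.neighborSet x).ncard = 3 := by
  have h : coxeterGraph.neighborSet x = ((neighbors x).toFinset : Set (ZMod 7 × Fin 4)) := by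
    ext y; simp [adj_iff_mem_neighbors]
  rw [h, Set.ncard_coe_finset, List.toFinset_card_of_nodup (nodup_neighbors x).1,
    (nodup_neighbors x).2]

theorem exists_adj_ne {x y : ZMod 7 × Fin 4} : ∃ s, s ≠ x ∧ coxeterGraph.Adj y s := by
  have h : 1 < (coxeterGraph.neighborSet y).ncard := by rw [neighborSet_ncard]; omega
  obtain ⟨s, hs, hsx⟩ := Set.exists_ne_of_one_lt_ncard h x
  exact ⟨s, hsx, hs⟩

theorem notMem_nonbacktrackEnds : ∀ v, ∀ c ∈ neighbors v, ∀ n < 6,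
    v ∉ nonbacktrackEnds neighbors n v c := by
  decide +kernel

theorem seven_le_of_closed (f : ℕ → ZMod 7 × Fin 4) (m : ℕ) (hm : 0 < m)
    (hadj : ∀ i < m, coxeterGraph.Adj (f i) (f (i + 1)))
    (hf : ∀ i, i + 2 ≤ m → f (i + 2) ≠ f i) (hclose : f m = f 0) : 7 ≤ m := by
  by_contra! hlt
  have hnb : ∀ i < m, f (i + 1) ∈ neighbors (f i) := fun i hi =>
    adj_iff_mem_neighbors.1 (hadj i hi)
  have hmem := mem_nonbacktrackEnds hnb hf (n := m - 1) 0 (by omega)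
  rw [show 0 + (m - 1) + 1 = m by omega, hclose] at hmem
  exact notMem_nonbacktrackEnds _ _ (hnb 0 hm) _ (by omega) hmem

theorem girth_splitVertex (x : ZMod 7 × Fin 4) : (splitVertex coxeterGraph x).girth = 7 := by
  by_cases hx : x.2 = 1
  -- The vertices of each nonzero track form a 7-cycle; one on a track not containing `x` is chosen.
  · refine splitVertex.girth_eq (by norm_num) seven_le_of_closed
      (l := [(0, 2), (2, 2), (4, 2), (6, 2), (1, 2), (3, 2), (5, 2)]) rfl ?_
      (by decide +kernel) (by decide +kernel) (by decide +kernel)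
    intro h
    simp only [List.mem_cons, List.not_mem_nil, or_false] at h
    rcases h with rfl | rfl | rfl | rfl | rfl | rfl | rfl <;> simp at hx
  · refine splitVertex.girth_eq (by norm_num) seven_le_of_closed
      (l := [(0, 1), (1, 1), (2, 1), (3, 1), (4, 1), (5, 1), (6, 1)]) rfl ?_
      (by decide +kernel) (by decide +kernel) (by decide +kernel)
    intro h
    simp only [List.mem_cons, List.not_mem_nil, or_false] at h
    rcases h with rfl | rfl | rfl | rfl | rfl | rfl | rfl <;> simp at hx

/-- The rotation by `t` columns. -/
def rotation (t : ZMod 7) : coxeterGraph ≃g coxeterGraph where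
  toEquiv := (Equiv.addRight t).prodCongr (Equiv.refl _)
  map_rel_iff' := by
    intro a b
    simp [coxeterGraph, fromRel_adj, add_right_comm _ t, Prod.ext_iff]

/-! ### Nonhamiltonicity of the Coxeter graph by a search on vertex numbers and bit masks. -/

/-- The number `4 * j + r` of the vertex `(j, r)`. -/
def encode (v : ZMod 7 × Fin 4) : ℕ := 4 * v.1.val + v.2.val

/-- The vertex with a given number. -/
def decode (n : ℕ) : ZMod 7 × Fin 4 := (((n / 4 : ℕ) : ZMod 7), Fin.ofNat 4 n)

theorem decode_encode : ∀ v, decode (encode v) = v := by decide +kernel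

theorem encode_decode : ∀ n < 28, encode (decode n) = n := by decide +kernel

theorem encode_lt : ∀ v, encode v < 28 := by decide +kernel

/-- The numbers of the neighbours of a vertex. -/
def codeNeighbors (v : ℕ) : List ℕ :=
  bif Nat.beq (v % 4) 0 then [v + 1, v + 2, v + 3]
  else [v - v % 4, (v + 4 * (v % 4)) % 28, (v + 28 - 4 * (v % 4)) % 28]

theorem encode_mem_codeNeighbors : ∀ a, ∀ b ∈ neighbors a, encode b ∈ codeNeighbors (encode a) := by
  decide +kernel

theorem mem_codeNeighbors : ∀ v < 28, ∀ w ∈ codeNeighbors v, w < 28 ∧ v ∈ codeNeighbors w ∧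
    coxeterGraph.Adj (decode v) (decode w) := by
  decide +kernel

/-- The number `w` does not belong to the set with bit mask `m`. -/
def isFree (m w : ℕ) : Bool := Nat.beq ((m >>> w) % 2) 0

theorem isFree_eq (m w : ℕ) : isFree m w = !m.testBit w := by
  rw [isFree, Nat.testBit_eq_decide_div_mod_eq, Nat.shiftRight_eq_div_pow]
  rcases Nat.mod_two_eq_zero_or_one (m / 2 ^ w) with h | h <;> rw [h] <;> rfl

/-- At least two neighbours of `z` are free or the starting vertex `0`. -/
def isViable (m z : ℕ) : Bool :=
  Nat.ble 2 ((codeNeighbors z).countP fun y => Nat.beq y 0 || isFree m y)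

/-- A path with vertex set `m` ending in `v` may be continued to `w`. -/
def canStep (m v w : ℕ) : Bool :=
  isFree m w && (codeNeighbors v).all fun z => Nat.beq z w || !isFree m z || isViable m z

/-- The search for Hamiltonian cycles through the vertex `0`: can a path with vertex set `m` that
ends in `v` be continued by `n` vertices and then closed? -/
def search : ℕ → ℕ → ℕ → Bool
  | 0, v, _ => (codeNeighbors v).any (Nat.beq 0)
  | n + 1, v, m => (codeNeighbors v).any fun w => canStep m v w && search n w (m ||| 2 ^ w)

theorem search_eq_false : search 27 0 1 = false := by decide +kernel

theorem isViable_of_mem {m z a b : ℕ} (hab : a ≠ b) (ha : a ∈ codeNeighbors z)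
    (hb : b ∈ codeNeighbors z) (ha' : a = 0 ∨ isFree m a) (hb' : b = 0 ∨ isFree m b) :
    isViable m z = true := by
  rw [isViable, Nat.ble_eq, List.countP_eq_length_filter]
  have hnd : [a, b].Nodup := by simpa using hab
  refine (hnd.subperm (l₂ := List.filter _ _) ?_).length_le
  intro c hc
  rw [List.mem_filter]
  simp only [List.mem_cons, List.not_mem_nil, or_false] at hc
  rcases hc with rfl | rfl
  · exact ⟨ha, by simpa using ha'⟩
  · exact ⟨hb, by simpa using hb'⟩

/-- Soundness of the pruned search: `l` is the rest of a Hamiltonian cycle, and following it passes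
every test. -/
theorem search_eq_true {n v m : ℕ} {l : List ℕ} (hn : l.length = n) (hv : v < 28)
    (hl : ∀ z ∈ l, z < 28) (hc : (v :: l).IsChain fun a b => b ∈ codeNeighbors a)
    (hlast : ∀ z ∈ (v :: l).getLast?, 0 ∈ codeNeighbors z) (hnd : l.Nodup) (h0 : 0 ∉ l)
    (hfree : ∀ z < 28, isFree m z = true ↔ z ∈ l) : search n v m = true := by
  induction n generalizing v m l with
  | zero =>
    obtain rfl := List.length_eq_zero_iff.1 hn
    simpa [search] using hlast v (by simp)
  | succ n ih =>
    obtain ⟨w, l, rfl⟩ := List.exists_cons_of_length_eq_add_one hn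
    rw [List.isChain_cons_cons] at hc
    rw [search, List.any_eq_true]
    refine ⟨w, hc.1, ?_⟩
    have hw : w < 28 := hl w (by simp)
    rw [Bool.and_eq_true, canStep, Bool.and_eq_true, List.all_eq_true]
    refine ⟨⟨(hfree w hw).2 (by simp), fun z hz => ?_⟩, ?_⟩
    · by_cases hzw : z = w
      · simp [hzw]
      by_cases hzf : isFree m z = true
      · have hz28 := (mem_codeNeighbors v hv z hz).1
        have hzl : z ∈ l := by simpa [hzw] using (hfree z hz28).1 hzf
        obtain ⟨l₁, l₂, rfl⟩ := List.append_of_mem hzl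
        obtain ⟨A, a, hA⟩ : ∃ A a, w :: l₁ = A ++ [a] := by
          rcases List.eq_nil_or_concat' (w :: l₁) with h | h
          · simp at h
          · exact h
        have hlist : w :: (l₁ ++ z :: l₂) = A ++ a :: z :: l₂ := by
          rw [← List.cons_append, hA]; simp
        rw [hlist] at hc hnd hl h0 hfree hlast
        rw [List.isChain_append_cons_cons] at hc
        obtain ⟨-, -, haz, hzl₂⟩ := hc
        have haz' := (mem_codeNeighbors a (hl a (by simp)) z haz).2.1
        have haf : isFree m a = true := (hfree a (hl a (by simp))).2 (by simp)
        -- A free neighbour `z ≠ w` of `v` occurs later on the cycle, so its predecessor `a` is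
        -- free, and its successor is free or, if `z` is last, the start 0.
        suffices isViable m z = true by simp [this]
        rcases l₂ with _ | ⟨b, l₂⟩
        · refine isViable_of_mem (b := 0) ?_ haz' (hlast z (by simp [List.getLast?_cons]))
            (Or.inr haf) (Or.inl rfl)
          rintro rfl; simp at h0
        · rw [List.isChain_cons_cons] at hzl₂
          refine isViable_of_mem (b := b) ?_ haz' hzl₂.1 (Or.inr haf)
            (Or.inr ((hfree b (hl b (by simp))).2 (by simp)))
          rintro rfl
          simp [List.nodup_append] at hnd
      · simp [hzf]
    · rw [List.nodup_cons] at hnd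
      refine ih (by simpa using hn) hw (fun z hz => hl z (by simp [hz])) hc.2 ?_ hnd.2
        (fun h => h0 (by simp [h])) fun z hz => ?_
      · intro z hz
        exact hlast z (by rw [List.getLast?_cons_cons]; exact hz)
      · have := hfree z hz
        rw [isFree_eq, Bool.not_eq_true', List.mem_cons] at this
        rw [isFree_eq, Nat.testBit_or, Nat.testBit_two_pow, Bool.not_eq_true', Bool.or_eq_false_iff,
          decide_eq_false_iff_not, this]
        constructor
        · rintro ⟨rfl | h, h'⟩
          · exact (h' rfl).elim
          · exact h
        · intro h
          refine ⟨Or.inr h, ?_⟩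
          rintro rfl
          exact hnd.1 h

/-- The Coxeter graph is not Hamiltonian. -/
theorem not_isHamiltonian_of_adj {x y : ZMod 7 × Fin 4} (p : coxeterGraph.Walk x y)
    (hp : p.IsHamiltonian) : ¬ coxeterGraph.Adj x y := by
  intro hadj
  have hnd := hp.isPath.support_nodup
  have hc := p.isChain_adj_support
  have hhead := p.head?_support
  have hlast := p.getLast?_support
  have hmem := hp.mem_support
  have hlen : p.support.length = 28 := by rw [hp.length_support]; rfl
  obtain ⟨A, B, hAB⟩ := List.append_of_mem (hp.mem_support (0, 0))
  rw [hAB] at hnd hc hhead hlast hmem hlen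
  -- The path closes up to a cycle, which is cut open at `(0, 0)`, the starting vertex of the
  -- search.
  have hc' : ((0, 0) :: B ++ A).IsChain coxeterGraph.Adj := by
    rw [List.isChain_append] at hc ⊢
    refine ⟨hc.2.1, hc.1, fun a ha b hb => ?_⟩
    rw [List.getLast?_append_of_ne_nil _ (by simp)] at hlast
    obtain rfl : y = a := by rw [hlast] at ha; simpa using ha
    obtain rfl : x = b := by
      rw [List.head?_append_of_ne_nil _ (by rintro rfl; simp at hb)] at hhead
      rw [hhead] at hb; simpa using hb
    exact hadj.symm
  have hlast' : ∀ z ∈ ((0, 0) :: B ++ A).getLast?, coxeterGraph.Adj z (0, 0) := by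
    intro z hz
    rcases List.eq_nil_or_concat' A with rfl | ⟨A, a, rfl⟩
    · simp only [List.nil_append, List.append_nil] at hlast hhead hz
      rw [hlast] at hz
      obtain rfl : y = z := by simpa using hz
      obtain rfl : (0, 0) = x := by simpa using hhead
      exact hadj.symm
    · rw [← List.append_assoc, List.getLast?_concat] at hz
      obtain rfl : a = z := by simpa using hz
      rw [List.append_assoc, List.singleton_append, List.isChain_append_cons_cons] at hc
      exact hc.2.1
  have hnd' : ((0, 0) :: B ++ A).Nodup := List.nodup_append_comm.1 hnd
  have hinj : Function.Injective encode := fun a b h => by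
    rw [← decode_encode a, h, decode_encode]
  have hmap : ((0, 0) :: B ++ A).map encode = 0 :: (B ++ A).map encode := rfl
  have hnd'' := hnd'.map hinj
  rw [hmap, List.nodup_cons] at hnd''
  have htrue : search 27 0 1 = true := by
    refine search_eq_true (l := (B ++ A).map encode) ?_ (by norm_num) ?_ ?_ ?_ hnd''.2 hnd''.1 ?_
    · simp at hlen ⊢; omega
    · intro z hz
      obtain ⟨v, -, rfl⟩ := List.mem_map.1 hz
      exact encode_lt v
    · rw [← hmap]
      exact List.isChain_map_of_isChain encode
        (fun a b h => encode_mem_codeNeighbors a b (adj_iff_mem_neighbors.1 h)) hc'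
    · intro z hz
      rw [← hmap, List.getLast?_map, Option.mem_def, Option.map_eq_some_iff] at hz
      obtain ⟨a, ha, rfl⟩ := hz
      exact encode_mem_codeNeighbors a (0, 0) (adj_iff_mem_neighbors.1 (hlast' a ha))
    · intro z hz
      rw [isFree_eq, Bool.not_eq_true', show (1 : ℕ) = 2 ^ 0 from rfl, Nat.testBit_two_pow,
        decide_eq_false_iff_not]
      refine ⟨fun h => ?_, fun h h' => hnd''.1 (h' ▸ h)⟩
      have hz' : decode z ∈ (0, 0) :: B ++ A := by
        have := hmem (decode z)
        simp only [List.mem_append, List.mem_cons] at this ⊢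
        tauto
      have := List.mem_map_of_mem (f := encode) hz'
      rw [hmap, encode_decode z hz, List.mem_cons] at this
      exact this.resolve_left (Ne.symm h)
  rw [search_eq_false] at htrue
  exact Bool.false_ne_true htrue


/-! ### Hamiltonian paths and almost Hamiltonian cycles of the Coxeter graph from certificates. -/

/-- The walk from `v` whose steps are the ternary digits of `c`: its end after `n` steps, and the bit
mask of its vertices together with `m`. -/
def trace : ℕ → ℕ → ℕ → ℕ → ℕ × ℕ
  | 0, _, v, m => (v, m ||| 2 ^ v)
  | n + 1, c, v, m => trace n (c / 3) ((codeNeighbors v).getD (c % 3) 0) (m ||| 2 ^ v)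

theorem length_codeNeighbors (v : ℕ) : (codeNeighbors v).length = 3 := by
  unfold codeNeighbors
  cases Nat.beq (v % 4) 0 <;> rfl

theorem joins_of_trace {n c v m v' M : ℕ} (hv : v < 28) (h : trace n c v m = (v', M)) :
    coxeterGraph.Joins (decode v) (decode v') n
      {x | M.testBit (encode x) = true ∧ m.testBit (encode x) = false} := by
  induction n generalizing c v m with
  | zero =>
    obtain ⟨rfl, rfl⟩ := Prod.mk.inj h
    refine (Joins.nil _).mono fun x hx => ?_
    obtain ⟨h1, h2⟩ := hx
    rw [Nat.testBit_or, h2, Bool.false_or, Nat.testBit_two_pow, decide_eq_true_eq] at h1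
    rw [Set.mem_singleton_iff, h1, decode_encode]
  | succ n ih =>
    have hlt : c % 3 < (codeNeighbors v).length := by
      rw [length_codeNeighbors]; exact Nat.mod_lt _ (by norm_num)
    have hmem : (codeNeighbors v).getD (c % 3) 0 ∈ codeNeighbors v := by
      rw [List.getD_eq_getElem _ _ hlt]; exact List.getElem_mem hlt
    obtain ⟨h28, -, hadj⟩ := mem_codeNeighbors v hv _ hmem
    refine (Joins.cons hadj (ih h28 h)).mono fun x hx => ?_
    obtain ⟨h1, h2⟩ := hx
    by_cases hxv : encode x = v
    · exact Or.inl (by rw [← hxv, decode_encode])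
    · refine Or.inr ⟨h1, ?_⟩
      rw [Nat.testBit_or, h2, Bool.false_or, Nat.testBit_two_pow, decide_eq_false_iff_not]
      exact Ne.symm hxv

/-- For `r < 4` and every `v` nonadjacent to `r` the steps of a Hamiltonian path from `r` to `v`. -/
def pathCode : List (List ℕ) := [
    [0, 0, 0, 0, 2275207333647, 5225720947053, 3811664482500, 4516725015417, 1740429092172,
     2703488726814, 3781512421122, 4341017580303, 2522516341647, 2679678033555, 2839997751627,
     4038758952492, 2275105283094, 422309870778, 3304742150343, 7601378685114, 2540976095685,
     5358968127192, 7619233048392, 3988661857599, 1160369743728, 2806509096804, 2923647181680,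
     7031095976055],
    [0, 0, 6034846047243, 3815351016825, 2275212879669, 0, 3755851754997, 7598986478373,
     1271692690761, 2679116401056, 3725167476858, 7622518371006, 1160989724730, 690370638501,
     6129763312044, 3814949805114, 2522773900569, 2691772223862, 7572480364479, 7409391518415,
     1269102009657, 5357438742171, 7619423788878, 3987132472578, 1159122953532, 0,
     3488530745055, 7622919582717],
    [0, 3435297863550, 0, 7005335930379, 1172097655623, 3771899692080, 3516318260316,
     7622642903238, 2061636592203, 5313855937248, 0, 3815074337346, 923652518238, 674702161551,
     6187258991997, 3988197340884, 2289848655942, 819780816429, 3531298532049, 7622642359107,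
     1269987162345, 5313855393117, 0, 3815073793215, 891583636059, 6865887546924, 7453757221947,
     7389832841262],
    [0, 2672631698277, 3582592851627, 0, 2539684328427, 3808622284158, 3812103759141,
     7003148898060, 2513755961262, 7536308696352, 3763165638411, 5842389901761, 2475821086596,
     2803366536300, 3811731192756, 0, 1349148571452, 3435277406427, 6034964546997, 0,
     2384593040259, 5224740522462, 7566697378467, 5664278401902, 938469181689, 6822190155540,
     7146147531204, 4374153932409]]

/-- For `r < 4` the steps of a cycle through the vertex `4` that misses only `r`. -/
def cycleCode : List ℕ := [2514165215316, 2463363769620, 1279283834172, 2367913639674]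

/-- The mask `2 ^ 28 - 1` says that all vertices are met. Table entries for `v = r` and for
neighbours of `r` are irrelevant placeholders. -/
theorem trace_pathCode : ∀ r < 4, ∀ v < 28, v ≠ r ∧ v ∉ codeNeighbors r →
    trace 27 ((pathCode.getD r []).getD v 0) r 0 = (v, 2 ^ 28 - 1) := by
  decide +kernel

theorem trace_cycleCode : ∀ r < 4,
    trace 27 (cycleCode.getD r 0) 4 0 = (4, 2 ^ 28 - 1 - 2 ^ r) := by
  decide +kernel

/-- Any two nonadjacent vertices of the Coxeter graph are joined by a Hamiltonian path. -/
theorem exists_isHamiltonian {u v : ZMod 7 × Fin 4} (huv : u ≠ v) (hadj : ¬ coxeterGraph.Adj u v) :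
    ∃ p : coxeterGraph.Walk u v, p.IsHamiltonian := by
  refine (rotation (-u.1)).exists_isHamiltonian ?_
  rw [← (rotation (-u.1)).map_adj_iff] at hadj
  have hne := (rotation (-u.1)).injective.ne huv
  have hu : (rotation (-u.1) u).1 = 0 := add_neg_cancel u.1
  generalize rotation (-u.1) u = u' at *
  generalize rotation (-u.1) v = v' at *
  have hlt : encode u' < 4 := by simp [encode, hu]
  have hmem : encode v' ∉ codeNeighbors (encode u') := fun h => by
    have := (mem_codeNeighbors _ (encode_lt u') _ h).2.2
    rw [decode_encode, decode_encode] at this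
    exact hadj this
  have hcode : encode v' ≠ encode u' := fun h =>
    hne (by rw [← decode_encode u', ← h, decode_encode])
  have hJ := joins_of_trace (encode_lt u')
    (trace_pathCode _ hlt _ (encode_lt v') ⟨hcode, hmem⟩)
  rw [decode_encode, decode_encode] at hJ
  refine hJ.exists_isHamiltonian rfl fun x => ?_
  exact ⟨by rw [Nat.testBit_two_pow_sub_one]; simp [encode_lt], Nat.zero_testBit _⟩

/-- The Coxeter graph has a cycle missing only a given vertex. -/
theorem exists_isPath_avoiding {x y : ZMod 7 × Fin 4} (hxy : x ≠ y) :
    ∃ (w : ZMod 7 × Fin 4) (p : coxeterGraph.Walk x w), p.IsPath ∧ coxeterGraph.Adj x w ∧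
      ∀ v, v ∈ p.support ↔ v ≠ y := by
  have hJ := (joins_of_trace (by norm_num) (trace_cycleCode y.2.val y.2.isLt)).of_iso
    (rotation y.1)
  refine hJ.exists_isPath rfl (fun v hv => ?_) hxy
  refine ⟨(v.1 - y.1, v.2), ?_, Prod.ext (sub_add_cancel _ _) rfl⟩
  have key : ∀ (r : Fin 4) (v : ZMod 7 × Fin 4), v ≠ (0, r) →
      (2 ^ 28 - 1 - 2 ^ r.val).testBit (encode v) = true := by decide +kernel
  refine ⟨key y.2 _ fun h => hv ?_, Nat.zero_testBit _⟩
  have h1 := congrArg Prod.fst h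
  have h2 := congrArg Prod.snd h
  exact Prod.ext (sub_eq_zero.1 h1) h2

theorem detourSaturated_splitVertex (x : ZMod 7 × Fin 4) :
    DetourSaturated (splitVertex coxeterGraph x) :=
  splitVertex.detourSaturated (neighborSet_ncard x) (fun _ p hp => not_isHamiltonian_of_adj p hp)
    (fun _ _ huv hadj => exists_isHamiltonian huv hadj)
    (fun _ hy => exists_isPath_avoiding hy.ne) (fun _ _ => exists_adj_ne)

end coxeterGraph

theorem theorem4 :
    {n : ℕ | ∃ G : SimpleGraph (Fin n), DetourSaturated G ∧ G.girth = 6}.Infinite ∧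
    (∀ k : ℕ, Odd k → 7 ≤ k → ∀ x : ZMod k × Fin 4,
      DetourSaturated (splitVertex (isaacsGraph k) x) ∧
      (splitVertex (isaacsGraph k) x).girth = 6 ∧
      Nat.card ({v : ZMod k × Fin 4 // v ≠ x} ⊕
        {y : ZMod k × Fin 4 // (isaacsGraph k).Adj x y}) = 4 * k + 2) ∧
    (∀ x : ZMod 7 × Fin 4,
      DetourSaturated (splitVertex coxeterGraph x) ∧
      (splitVertex coxeterGraph x).girth = 7 ∧
      Nat.card ({v : ZMod 7 × Fin 4 // v ≠ x} ⊕
        {y : ZMod 7 × Fin 4 // coxeterGraph.Adj x y}) = 30) := by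
  have hJ : ∀ k : ℕ, Odd k → 7 ≤ k → ∀ x : ZMod k × Fin 4,
      DetourSaturated (splitVertex (isaacsGraph k) x) ∧
      (splitVertex (isaacsGraph k) x).girth = 6 ∧
      Nat.card ({v : ZMod k × Fin 4 // v ≠ x} ⊕
        {y : ZMod k × Fin 4 // (isaacsGraph k).Adj x y}) = 4 * k + 2 := by
    intro k hodd hk x
    have : NeZero k := ⟨by omega⟩
    refine ⟨isaacsGraph.detourSaturated_splitVertex hodd hk x,
      isaacsGraph.girth_splitVertex (by omega) x, ?_⟩
    rw [splitVertex.card_eq (isaacsGraph.neighborSet_ncard (by omega) x)]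
    simp [ZMod.card, mul_comm]
  refine ⟨?_, hJ, fun x => ⟨coxeterGraph.detourSaturated_splitVertex x,
    coxeterGraph.girth_splitVertex x, splitVertex.card_eq (coxeterGraph.neighborSet_ncard x)⟩⟩
  -- The orders `4k + 2` for the odd numbers `k = 2i + 7`.
  refine Set.infinite_of_injective_forall_mem (f := fun i : ℕ => 4 * (2 * i + 7) + 2)
    (fun i j h => by simp only at h; omega) fun i => ?_
  have : NeZero (2 * i + 7) := ⟨by omega⟩
  obtain ⟨h1, h2, h3⟩ := hJ (2 * i + 7) ⟨i + 3, by ring⟩ (by omega) 0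
  let e := Finite.equivFinOfCardEq h3
  let φ := Iso.map e (splitVertex (isaacsGraph (2 * i + 7)) 0)
  exact ⟨_, h1.of_iso φ, by rw [← φ.girth_eq, h2]⟩
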